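/- **Conventions.** A circuit is a Boolean circuit with constants and arbitrary fan-in-two gates; its size is its number of gates. Distributions $(X_1,Z_1)$, $(X_2,Z_2)$ on $\{0,1\}^n\times\{0,1\}^m$ are $(s,\epsilon)$-indistinguishable if $|\mathbb{E}\,D(X_1,Z_1)-\mathbb{E}\,D(X_2,Z_2)|\le\epsilon$ for every circuit $D:\{0,1\}^{n+m}\to\{0,1\}$ of size at most $s$. Conditional min-entropy is worst-case: $\mathbf{H}_\infty(X|Z)=-\log_2\max_{x,\;z:\Pr[Z=z]>0}\Pr[X=x\mid Z=z]$. A randomized circuit has complexity $t$ relative to circuits of size $s$ if its number of uniform random input bits plus its number of gates is $t$, where a gate is a constant, a Boolean function of two wires, or one evaluation (at unit cost) on $n+m$ wires of a function $\{0,1\}^{n+m}\to\{0,1\}$ that has a circuit of size at most $s$. **Theorem (High conditional min-entropy is simulatable).** There is a universal constant $C>0$ such that the following holds for all integers $n,m,s\ge 0$, all $\epsilon\in(0,1]$ and all real $\Delta$. Let $X\in\{0,1\}^n$ and $Z\in\{0,1\}^m$ be correlated random variables with $\mathbf{H}_\infty(X|Z)=n-\Delta$. Then there is a distribution $(Y,Z)$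 on $\{0,1\}^n\times\{0,1\}^m$, with the same marginal $Z$, such that (a) there is a randomized circuit $\mathsf{Sim}$ from $m$ bits to $n$ bits, of complexity at most $C\cdot n(n+m)2^{2\Delta}\epsilon^{-5}$ relative to circuits of size $s$, such that $(\mathsf{Sim}(Z),Z)\overset{d}{=}(Y,Z)$, where the random bits of $\mathsf{Sim}$ are independent of $Z$; (b) $(X,Z)$ and $(Y,Z)$ are $(s,\epsilon)$-indistinguishable; (c) $\mathbf{H}_\infty(Y|Z)\ge n-\Delta-6$. -/

import Mathlib

/-- Bit strings of length `n`. -/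
abbrev Bits (n : ℕ) : Type := Fin n → Bool

/-- A gate reading some of the `w` wires computed so far: a constant, an arbitrary Boolean function
of two wires, or one evaluation of a function `D` from the class `Q` on `q` wires. -/
inductive Gate {q : ℕ} (Q : Set (Bits q → Bool)) (w : ℕ) : Type
  | const (b : Bool) : Gate Q w
  | binary (f : Bool → Bool → Bool) (i j : Fin w) : Gate Q w
  | query (D : Bits q → Bool) (hD : D ∈ Q) (args : Fin q → Fin w) : Gate Q w

/-- The bit that a gate produces from the values `v` of the existing wires. -/
def Gate.val {q : ℕ} {Q : Set (Bits q → Bool)} {w : ℕ} (g : Gate Q w) (v : Bits w) : Bool :=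
  match g with
  | .const b => b
  | .binary f i j => f (v i) (v j)
  | .query D _ args => D (fun a => v (args a))

/-- Circuits (straight-line programs, so fan-out is unbounded) relative to the class `Q`, with
`k` input wires and `t` gates; each gate adds one wire. For `Q = ∅` these are the ordinary Boolean
circuits of fan-in two. -/
inductive Circuit {q : ℕ} (Q : Set (Bits q → Bool)) (k : ℕ) : ℕ → Type
  | inputs : Circuit Q k 0
  | snoc {t : ℕ} (c : Circuit Q k t) (g : Gate Q (k + t)) : Circuit Q k (t + 1)

/-- The values of all wires (first the inputs, then the gates in order) on a given input. -/
def Circuit.eval {q : ℕ} {Q : Set (Bits q → Bool)} {k : ℕ} :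
    {t : ℕ} → Circuit Q k t → Bits k → Bits (k + t)
  | _, .inputs, x => x
  | _, .snoc c g, x => Fin.snoc (α := fun _ => Bool) (c.eval x) (g.val (c.eval x))

/-- The Boolean functions of `k` bits computed by ordinary Boolean circuits of size at most `s`
(size = number of gates). -/
def sizeClass (k s : ℕ) : Set (Bits k → Bool) :=
  {f | ∃ t ≤ s, ∃ c : Circuit (∅ : Set (Bits 0 → Bool)) k t, ∃ o : Fin (k + t),
    ∀ x, f x = c.eval x o}

/-- A randomized circuit relative to `Q`, mapping `m` bits to `n` bits: its input wires are the
`m` input bits followed by `coins` random bits, and `out` names the wires that are output. -/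
structure RandCircuit {q : ℕ} (Q : Set (Bits q → Bool)) (m n : ℕ) where
  coins : ℕ
  gates : ℕ
  circuit : Circuit Q (m + coins) gates
  out : Fin n → Fin (m + coins + gates)

namespace RandCircuit

variable {q : ℕ} {Q : Set (Bits q → Bool)} {m n : ℕ}

/-- The complexity relative to `Q`: number of random bits plus number of gates, where each
evaluation of a member of `Q` is one gate. -/
def complexity (S : RandCircuit Q m n) : ℕ := S.coins + S.gates

/-- The output on input `z` with random bits `r`. -/
def run (S : RandCircuit Q m n) (z : Bits m) (r : Bits S.coins) : Bits n :=
  fun i => S.circuit.eval (Fin.append z r) (S.out i)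

/-- The law of the output on input `z`, for uniform and independent random bits. -/
noncomputable def outputLaw (S : RandCircuit Q m n) (z : Bits m) : PMF (Bits n) :=
  (PMF.uniformOfFintype (Bits S.coins)).map (S.run z)

/-- The law of `(S(Z), Z)` for `Z` distributed as `μ` and independent of the random bits. -/
noncomputable def jointLaw (S : RandCircuit Q m n) (μ : PMF (Bits m)) : PMF (Bits n × Bits m) :=
  μ.bind fun z => (S.outputLaw z).map fun y => (y, z)

end RandCircuit

/-- The law of the second component. -/
noncomputable def sndLaw {n m : ℕ} (P : PMF (Bits n × Bits m)) : PMF (Bits m) :=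
  P.map Prod.snd

/-- The (worst-case) conditional min-entropy of `X` given `Z`, for `(X, Z)` with law `P`:
`-log₂ max Pr[X = x | Z = z]`, the maximum being over all `x` and all `z` with `Pr[Z = z] > 0`.
(A `z` of probability zero contributes `0 / 0 = 0`, which does not affect the maximum.) -/
noncomputable def condMinEntropy {n m : ℕ} (P : PMF (Bits n × Bits m)) : ℝ :=
  -Real.logb 2 (⨆ p : Bits n × Bits m, (P p).toReal / (sndLaw P p.2).toReal)

/-- The expectation of `D(X, Z)`, for `(X, Z)` with law `P` and `D` with values in `{0, 1}`. -/
noncomputable def expect {n m : ℕ} (P : PMF (Bits n × Bits m)) (D : Bits (n + m) → Bool) : ℝ :=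
  ∑ p : Bits n × Bits m, (P p).toReal * (if D (Fin.append p.1 p.2) then 1 else 0)

/-- `(s, ε)`-indistinguishability: no circuit of size at most `s` has advantage above `ε`. -/
def Indistinguishable {n m : ℕ} (s : ℕ) (ε : ℝ) (P P' : PMF (Bits n × Bits m)) : Prop :=
  ∀ D ∈ sizeClass (n + m) s, |expect P D - expect P' D| ≤ ε

open scoped BigOperators

/-! ### Second moments of sums of independent samples -/

section FiniteExpectation

variable {ι α : Type*} [Fintype ι] [DecidableEq ι] [Fintype α]

/-! The simulator is a follow-the-perturbed-leader strategy. Let `K = 2 ^ δ` exceed `2 ^ Δ` by at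
most a factor of two, so that each conditional law of X has density at most `K` against the uniform
law. Given z, draw `k = K * h ^ 2` uniform strings with `h` about 1/ε, score each by the number of
accepting tests from a fixed list `ds`, add independent noise uniform on `{0, …, N - 1}`, and output
a random one of the `L = h ^ 2` strings of largest key.

Min-entropy is automatic: the output is always one of the uniform samples, so no string has
probability above `k / L = K` times `2 ^ (-n)`, whatever the list (`leaderMean_indicator_le`).

Indistinguishability comes from choosing `ds` greedily (`exists_list_forall_le`). The potential is
the mean key of the leaders minus the mean score under X, averaged over Z. It starts at most `N`.
Appending a test d of advantage above ε raises the first term by at most the leaders' old acceptance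
of d plus `K / N`, since the noise makes the leaders stable (`leaderKey_add_le`), and raises the
second by X's acceptance of d; so the potential drops by more than `ε - K / N`. After `T` rounds it
is still at least `-T / h`: the samples imitate X up to sampling error (`exists_weights`), and the
leaders do at least as well as any such imitation (`sub_le_leaderKey`). For large `T` this is a
contradiction, so the search stops.

Scoring (`T = 2k`) and pairwise ranking cost order `k ^ 2` times the word length, giving the
complexity bound (`exists_simulator`). -/

lemma expect_pi_split (i : ι) (f : (ι → α) → ℝ) :
    𝔼 x, f x = 𝔼 a, 𝔼 y : {j // j ≠ i} → α, f ((Equiv.funSplitAt i α).symm (a, y)) := by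
  rw [← Finset.expect_product', Finset.univ_product_univ]
  exact Fintype.expect_equiv (Equiv.funSplitAt i α) _ _ fun x =>
    congrArg f ((Equiv.funSplitAt i α).symm_apply_apply x).symm

lemma expect_pi_apply [Nonempty α] (i : ι) (g : α → ℝ) : 𝔼 x : ι → α, g (x i) = 𝔼 a, g a := by
  simp [expect_pi_split i, Equiv.funSplitAt, Equiv.piSplitAt]

lemma expect_pi_mul_eq_zero {i j : ι} (hij : i ≠ j) (b : α → ℝ) (hb : 𝔼 a, b a = 0) :
    𝔼 x : ι → α, b (x i) * b (x j) = 0 := by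
  rw [expect_pi_split i, Finset.expect_comm]
  simp only [Equiv.funSplitAt, Equiv.piSplitAt, Equiv.coe_fn_symm_mk, dite_true, hij.symm,
    dite_false, ← Finset.expect_mul, hb, zero_mul, Finset.expect_const_zero]

/-- The cross terms vanish by independence, so variances add. -/
lemma expect_sq_sum_centered [Nonempty α] (b : α → ℝ) (hb : 𝔼 a, b a = 0) :
    𝔼 x : ι → α, (∑ i, b (x i)) ^ 2 = Fintype.card ι * 𝔼 a, b a ^ 2 := by
  simp_rw [sq, Finset.sum_mul_sum, Finset.expect_sum_comm]
  have h : ∀ i j : ι, 𝔼 x : ι → α, b (x i) * b (x j) = if i = j then 𝔼 a, b a * b a else 0 := by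
    intro i j
    split_ifs with h
    · subst h
      exact expect_pi_apply i fun a => b a * b a
    · exact expect_pi_mul_eq_zero h b hb
  simp [h]

end FiniteExpectation

/-! ### Ranking by key and the leading items -/

section Rank

variable {k : ℕ}

/-- Whether item `i` precedes item `j` in the order by decreasing key, ties broken by index. -/
def beats (u : Fin k → ℕ) (i j : Fin k) : Bool :=
  if i < j then decide (u j ≤ u i) else decide (u j < u i)

/-- The position of item `j` in the order by decreasing key. -/
def keyRank (u : Fin k → ℕ) (j : Fin k) : ℕ := ∑ i, (beats u i j).toNat

/-- The first `L` items in the order by decreasing key. -/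
def topItems (L : ℕ) (u : Fin k → ℕ) : Finset (Fin k) :=
  Finset.univ.filter fun j => keyRank u j < L

lemma mem_topItems {L : ℕ} {u : Fin k → ℕ} {j : Fin k} : j ∈ topItems L u ↔ keyRank u j < L := by
  simp [topItems]

lemma beats_self (u : Fin k → ℕ) (j : Fin k) : beats u j j = false := by simp [beats]

lemma beats_total (u : Fin k → ℕ) {i j : Fin k} (h : i ≠ j) : beats u i j ∨ beats u j i := by
  rcases lt_or_gt_of_ne h with h | h <;> simp [beats, h, h.not_gt] <;> omega

lemma beats_trans {u : Fin k → ℕ} {i j l : Fin k} (h₁ : beats u i j) (h₂ : beats u j l) :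
    beats u i l := by
  unfold beats at *
  split_ifs at * <;> simp only [decide_eq_true_eq, Fin.lt_def] at * <;> omega

lemma keyRank_lt_of_beats {u : Fin k → ℕ} {i j : Fin k} (h : beats u i j) :
    keyRank u i < keyRank u j := by
  refine Finset.sum_lt_sum (fun l _ => ?_) ⟨i, Finset.mem_univ _, by simp [beats_self, h]⟩
  cases hl : beats u l i
  · simp
  · simp [beats_trans hl h]

lemma keyRank_injective (u : Fin k → ℕ) : Function.Injective (keyRank u) := by
  intro i j hij
  by_contra h
  rcases beats_total u h with h | h
  · exact (keyRank_lt_of_beats h).ne hij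
  · exact (keyRank_lt_of_beats h).ne' hij

lemma keyRank_lt (u : Fin k → ℕ) (j : Fin k) : keyRank u j < k := by
  calc keyRank u j < ∑ _i : Fin k, 1 :=
        Finset.sum_lt_sum (fun i _ => Bool.toNat_le _) ⟨j, Finset.mem_univ _, by simp [beats_self]⟩
    _ = k := by simp

/-- Monotonicity behind the stability of the leaders: raising one's own key while the others fall
creates no new predecessor. -/
lemma keyRank_le_of_le {u v : Fin k → ℕ} {j : Fin k} (hj : u j ≤ v j)
    (h : ∀ i, i ≠ j → v i ≤ u i) : keyRank v j ≤ keyRank u j := by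
  refine Finset.sum_le_sum fun i _ => ?_
  rcases eq_or_ne i j with rfl | hij
  · simp [beats_self]
  · have := h i hij
    unfold beats
    split_ifs <;> apply Bool.toNat_le_toNat <;> simp only [Bool.le_iff_imp, decide_eq_true_eq] <;>
      omega

/-- The items in the order by decreasing key. -/
noncomputable def rankEquiv (u : Fin k → ℕ) : Fin k ≃ Fin k :=
  Equiv.ofBijective (fun j => ⟨keyRank u j, keyRank_lt u j⟩) <|
    Finite.injective_iff_bijective.1 fun _ _ h => keyRank_injective u (Fin.ext_iff.1 h)

lemma rankEquiv_apply (u : Fin k → ℕ) (j : Fin k) : (rankEquiv u j : ℕ) = keyRank u j := rfl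

lemma keyRank_rankEquiv_symm (u : Fin k → ℕ) (r : Fin k) : keyRank u ((rankEquiv u).symm r) = r := by
  rw [← rankEquiv_apply, Equiv.apply_symm_apply]

lemma sum_topItems {M : Type*} [AddCommMonoid M] {L : ℕ} (hL : L ≤ k) (u : Fin k → ℕ)
    (g : Fin k → M) :
    ∑ j ∈ topItems L u, g j = ∑ r : Fin L, g ((rankEquiv u).symm (Fin.castLE hL r)) := by
  symm
  refine Finset.sum_bij (fun r _ => (rankEquiv u).symm (Fin.castLE hL r)) ?_ ?_ ?_ ?_
  · intro r _
    rw [mem_topItems, keyRank_rankEquiv_symm]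
    exact r.2
  · intro r _ r' _ h
    simpa using h
  · intro j hj
    refine ⟨⟨keyRank u j, mem_topItems.1 hj⟩, Finset.mem_univ _, ?_⟩
    rw [Equiv.symm_apply_eq]
    rfl
  · simp

lemma card_topItems {L : ℕ} (hL : L ≤ k) (u : Fin k → ℕ) : (topItems L u).card = L := by
  rw [Finset.card_eq_sum_ones, sum_topItems hL]
  simp

lemma le_of_mem_topItems {L : ℕ} {u : Fin k → ℕ} {i j : Fin k} (hj : j ∈ topItems L u)
    (hi : i ∉ topItems L u) : u i ≤ u j := by
  by_contra h
  have hij : i ≠ j := by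
    rintro rfl
    exact hi hj
  have : beats u i j := by
    unfold beats
    split_ifs <;> simp <;> omega
  have := keyRank_lt_of_beats this
  rw [mem_topItems] at hi hj
  omega

/-- Fractional knapsack: the leaders beat every fractional choice of total weight at most `L`,
because moving weight across the threshold to a leader cannot lose. -/
lemma sum_mul_le_sum_topItems {L : ℕ} (hL : L ≤ k) (u : Fin k → ℕ) (c : Fin k → ℝ)
    (hc₀ : ∀ j, 0 ≤ c j) (hc₁ : ∀ j, c j ≤ 1) (hc : ∑ j, c j ≤ L) :
    ∑ j, c j * u j ≤ ∑ j ∈ topItems L u, (u j : ℝ) := by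
  -- The threshold is the largest key outside the leaders; it defaults to 0 when all items lead,
  -- which is still below every key.
  set τ : ℕ := (topItems L u)ᶜ.sup u with hτ
  have h₁ : ∀ j ∈ topItems L u, c j * (u j : ℝ) ≤ u j - τ * (1 - c j) := by
    intro j hj
    have : (τ : ℝ) ≤ u j := by
      exact_mod_cast Finset.sup_le fun i hi => le_of_mem_topItems hj (Finset.mem_compl.1 hi)
    nlinarith [hc₁ j]
  have h₂ : ∀ j ∈ (topItems L u)ᶜ, c j * (u j : ℝ) ≤ τ * c j := by
    intro j hj
    have : (u j : ℝ) ≤ τ := by exact_mod_cast Finset.le_sup (f := u) hj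
    nlinarith [hc₀ j]
  have h₃ := Finset.sum_le_sum h₁
  have h₄ := Finset.sum_le_sum h₂
  rw [Finset.sum_sub_distrib, ← Finset.mul_sum, Finset.sum_sub_distrib] at h₃
  rw [← Finset.mul_sum] at h₄
  simp only [Finset.sum_const, card_topItems hL, nsmul_eq_mul, mul_one] at h₃
  rw [← Finset.sum_add_sum_compl (topItems L u)] at hc ⊢
  nlinarith [mul_nonneg (Nat.cast_nonneg (α := ℝ) τ) (sub_nonneg.2 hc)]

lemma sum_le_sum_topItems {L : ℕ} (hL : L ≤ k) (u : Fin k → ℕ) (s : Finset (Fin k))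
    (hs : s.card ≤ L) : ∑ j ∈ s, (u j : ℝ) ≤ ∑ j ∈ topItems L u, (u j : ℝ) := by
  have := sum_mul_le_sum_topItems hL u (fun j => if j ∈ s then 1 else 0)
    (fun j => by split_ifs <;> simp) (fun j => by split_ifs <;> simp) (by simpa using hs)
  simpa using this

end Rank

/-! ### Imitating a bounded density by uniform samples -/

section Sampling

variable {α : Type*} [Fintype α] [Nonempty α]

lemma abs_le_sq_div_add {y h : ℝ} (hh : 0 < h) : |y| ≤ (y ^ 2 / h + h) / 2 := by
  rw [← sq_abs y, div_add' _ _ _ hh.ne', div_div, le_div_iff₀ (by positivity)]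
  nlinarith [sq_nonneg (|y| - h)]

/-- A density bounded by `K` is matched, up to sampling error, by weights on `K * h ^ 2` uniform
samples that total at most `h ^ 2` and are at most `1` each. -/
lemma exists_weights {K h k : ℕ} (hK : 0 < K) (hh : 0 < h) (hk : k = K * h ^ 2) (p : α → ℝ)
    (hp₀ : ∀ a, 0 ≤ p a) (hp : ∑ a, p a = 1) (hpK : ∀ a, p a * Fintype.card α ≤ K) :
    ∃ c : (Fin k → α) → Fin k → ℝ, (∀ x j, 0 ≤ c x j) ∧ (∀ x j, c x j ≤ 1) ∧
      (∀ x, ∑ j, c x j ≤ (h ^ 2 : ℕ)) ∧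
      ∀ (B : ℝ) (φ : α → ℝ), (∀ a, 0 ≤ φ a) → (∀ a, φ a ≤ B) →
        (h : ℝ) ^ 2 * ∑ a, p a * φ a - B * h ≤ 𝔼 x, ∑ j, c x j * φ (x j) := by
  have hK' : (0 : ℝ) < K := by exact_mod_cast hK
  have hh' : (0 : ℝ) < h := by exact_mod_cast hh
  have hα : (0 : ℝ) < Fintype.card α := by exact_mod_cast Fintype.card_pos
  -- The acceptance probability of rejection sampling; the density bound is what makes it at most 1.
  set a : α → ℝ := fun y => p y * Fintype.card α / K with ha
  have ha₀ : ∀ y, 0 ≤ a y := fun y => by have := hp₀ y; positivity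
  have ha₁ : ∀ y, a y ≤ 1 := fun y => by rw [ha, div_le_one hK']; exact hpK y
  set S : (Fin k → α) → ℝ := fun x => ∑ j, a (x j) with hS
  have haφ : ∀ φ : α → ℝ, 𝔼 y, a y * φ y = (∑ y, p y * φ y) / K := by
    intro φ
    rw [Fintype.expect_eq_sum_div_card, Finset.sum_div, Finset.sum_div]
    refine Finset.sum_congr rfl fun y _ => ?_
    simp only [ha]
    field_simp
  have hmean : 𝔼 y, a y = 1 / K := by simpa [hp] using haφ fun _ => 1
  -- The total weight has mean `k / K = h ^ 2`, and `a ^ 2 ≤ a` bounds its variance by its mean.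
  have hvar : 𝔼 x, (S x - (h : ℝ) ^ 2) ^ 2 ≤ (h : ℝ) ^ 2 := by
    have hb : 𝔼 y, (a y - 1 / K) = 0 := by
      rw [Finset.expect_sub_distrib, hmean, Fintype.expect_const, sub_self]
    have h₁ := expect_sq_sum_centered (ι := Fin k) (fun y => a y - 1 / K) hb
    have h₂ : ∀ x : Fin k → α, ∑ j, (a (x j) - 1 / K) = S x - (h : ℝ) ^ 2 := by
      intro x
      rw [Finset.sum_sub_distrib]
      simp only [Finset.sum_const, Finset.card_univ, Fintype.card_fin, nsmul_eq_mul, hk]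
      push_cast
      field_simp
      rfl
    simp_rw [h₂] at h₁
    rw [h₁, Fintype.card_fin]
    have h₃ : 𝔼 y, (a y - 1 / K) ^ 2 ≤ (1 / K : ℝ) := by
      have : 𝔼 y, (a y - 1 / K) ^ 2 ≤ 𝔼 y, (a y - 2 / K * a y + (1 / K) ^ 2) := by
        refine Finset.expect_le_expect fun y _ => ?_
        have : a y ^ 2 ≤ a y := by nlinarith [ha₀ y, ha₁ y]
        have : (a y - 1 / K) ^ 2 = a y ^ 2 - 2 / K * a y + (1 / K) ^ 2 := by ring
        linarith
      rw [Finset.expect_add_distrib, Finset.expect_sub_distrib, ← Finset.mul_expect, hmean,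
        Fintype.expect_const] at this
      have h0 : (0 : ℝ) ≤ (1 / K) ^ 2 := by positivity
      have h1 : (1 / K - 2 / K * (1 / K) + (1 / K) ^ 2 : ℝ) = 1 / K - (1 / K) ^ 2 := by ring
      linarith
    calc (k : ℝ) * 𝔼 y, (a y - 1 / K) ^ 2 ≤ k * (1 / K) := by gcongr
      _ = (h : ℝ) ^ 2 := by rw [hk]; push_cast; field_simp
  have habs : 𝔼 x, |S x - (h : ℝ) ^ 2| ≤ (h : ℝ) := by
    calc 𝔼 x, |S x - (h : ℝ) ^ 2| ≤ 𝔼 x, ((S x - (h : ℝ) ^ 2) ^ 2 / h + h) / 2 :=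
          Finset.expect_le_expect fun x _ => abs_le_sq_div_add hh'
      _ = ((𝔼 x, (S x - (h : ℝ) ^ 2) ^ 2) / h + h) / 2 := by
          rw [← Finset.expect_div, Finset.expect_add_distrib, ← Finset.expect_div,
            Fintype.expect_const]
      _ ≤ ((h : ℝ) ^ 2 / h + h) / 2 := by gcongr
      _ = h := by field_simp; ring
  have hM : ∀ x, (0 : ℝ) < max ((h : ℝ) ^ 2) (S x) := fun x => lt_max_of_lt_left (by positivity)
  -- Scaling down only when the total exceeds `h ^ 2` enforces the cap, at a cost of at most `B`
  -- times the deviation of the total, which is at most `h` on average.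
  refine ⟨fun x j => a (x j) * (h ^ 2 / max ((h : ℝ) ^ 2) (S x)), ?_, ?_, ?_, ?_⟩
  · intro x j
    have := ha₀ (x j)
    have := hM x
    positivity
  · intro x j
    have h1 : (h : ℝ) ^ 2 / max ((h : ℝ) ^ 2) (S x) ≤ 1 := by
      rw [div_le_one (hM x)]
      exact le_max_left _ _
    exact mul_le_one₀ (ha₁ _) (by have := hM x; positivity) h1
  · intro x
    rw [← Finset.sum_mul, mul_div_assoc', div_le_iff₀ (hM x), mul_comm]
    push_cast
    gcongr
    exact le_max_right _ _
  · intro B φ hφ₀ hφ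
    have hB : 0 ≤ B := (hφ₀ (Classical.arbitrary α)).trans (hφ _)
    have key : ∀ x : Fin k → α, ∑ j, a (x j) * φ (x j) - B * |S x - (h : ℝ) ^ 2| ≤
        ∑ j, a (x j) * (h ^ 2 / max ((h : ℝ) ^ 2) (S x)) * φ (x j) := by
      intro x
      have h1 : (h : ℝ) ^ 2 / max ((h : ℝ) ^ 2) (S x) ≤ 1 := by
        rw [div_le_one (hM x)]
        exact le_max_left _ _
      have h2 : ∑ j, a (x j) * φ (x j) ≤ B * S x := by
        rw [hS, Finset.mul_sum]
        refine Finset.sum_le_sum fun j _ => ?_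
        rw [mul_comm]
        exact mul_le_mul_of_nonneg_right (hφ _) (ha₀ _)
      have h3 : S x * (1 - h ^ 2 / max ((h : ℝ) ^ 2) (S x)) ≤ |S x - (h : ℝ) ^ 2| := by
        rcases le_total (S x) ((h : ℝ) ^ 2) with hle | hle
        · rw [max_eq_left hle, div_self (by positivity), sub_self, mul_zero]
          exact abs_nonneg _
        · have : 0 < S x := lt_of_lt_of_le (by positivity) hle
          rw [max_eq_right hle]
          refine le_trans (le_of_eq ?_) (le_abs_self _)
          field_simp
      have h4 : ∑ j, a (x j) * (h ^ 2 / max ((h : ℝ) ^ 2) (S x)) * φ (x j) =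
          ∑ j, a (x j) * φ (x j) -
            (∑ j, a (x j) * φ (x j)) * (1 - h ^ 2 / max ((h : ℝ) ^ 2) (S x)) := by
        rw [mul_sub, mul_one, sub_sub_cancel, Finset.sum_mul]
        exact Finset.sum_congr rfl fun j _ => by ring
      rw [h4]
      have h5 := mul_le_mul_of_nonneg_right h2 (sub_nonneg.2 h1)
      have h6 := mul_le_mul_of_nonneg_left h3 hB
      linarith
    have hmean' : 𝔼 x : Fin k → α, ∑ j, a (x j) * φ (x j) = h ^ 2 * ∑ y, p y * φ y := by
      rw [Finset.expect_sum_comm]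
      simp_rw [expect_pi_apply (ι := Fin k) _ fun y => a y * φ y]
      rw [haφ]
      simp only [Finset.sum_const, Finset.card_univ, Fintype.card_fin, nsmul_eq_mul, hk]
      push_cast
      field_simp
    calc (h : ℝ) ^ 2 * ∑ y, p y * φ y - B * h
        ≤ 𝔼 x : Fin k → α, (∑ j, a (x j) * φ (x j) - B * |S x - (h : ℝ) ^ 2|) := by
          rw [Finset.expect_sub_distrib, hmean', ← Finset.mul_expect]
          gcongr
      _ ≤ _ := Finset.expect_le_expect fun x _ => key x

end Sampling

/-! ### Follow the perturbed leader, and boosting -/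

section PerturbedLeader

variable {k N : ℕ} [NeZero N]

/-- Coupling: one more unit of noise at `j` alone compensates for the growth of its key, and the
other keys were no larger before. -/
lemma expect_mem_topItems_le {L : ℕ} {u v : Fin k → ℕ} (huv : ∀ j, u j ≤ v j)
    (hvu : ∀ j, v j ≤ u j + 1) (j : Fin k) :
    𝔼 ν : Fin k → Fin N, (if j ∈ topItems L (fun i => v i + ν i) then (1 : ℝ) else 0) ≤
      𝔼 ν : Fin k → Fin N, (if j ∈ topItems L (fun i => u i + ν i) then (1 : ℝ) else 0) +
        1 / N := by
  have hN : 0 < N := Nat.pos_of_neZero N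
  -- A measure-preserving cyclic shift of coordinate `j`; it fails to raise the noise only when it
  -- wraps around from `N - 1`, an event of probability `1 / N`.
  set e : (Fin k → Fin N) ≃ (Fin k → Fin N) := Equiv.addRight (Pi.single j 1) with he
  have hpoint : ∀ ν : Fin k → Fin N,
      (if j ∈ topItems L (fun i => v i + ν i) then (1 : ℝ) else 0) ≤
        (if j ∈ topItems L (fun i => u i + e ν i) then (1 : ℝ) else 0) +
          if ν j = ⟨N - 1, by omega⟩ then 1 else 0 := by
    intro ν
    by_cases hj : ν j = ⟨N - 1, by omega⟩
    · simp only [hj, if_true]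
      split_ifs <;> norm_num
    have hlt : (ν j : ℕ) + 1 < N := by
      have h := (ν j).2
      have : (ν j : ℕ) ≠ N - 1 := fun h => hj (Fin.ext h)
      omega
    have hej : (e ν j : ℕ) = ν j + 1 := by
      simp only [he, Equiv.coe_addRight, Pi.add_apply, Pi.single_eq_same, Fin.val_add]
      rw [Fin.val_one', Nat.mod_eq_of_lt (a := 1) (by omega), Nat.mod_eq_of_lt hlt]
    have hei : ∀ i, i ≠ j → e ν i = ν i := by
      intro i hi
      simp [he, hi]
    have himp : j ∈ topItems L (fun i => v i + ν i) → j ∈ topItems L (fun i => u i + e ν i) := by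
      simp only [mem_topItems]
      refine lt_of_le_of_lt (keyRank_le_of_le ?_ fun i hi => ?_)
      · have := hvu j
        rw [hej]
        omega
      · rw [hei i hi]
        exact Nat.add_le_add_right (huv i) _
    simp only [hj, if_false, add_zero]
    split_ifs with h₁ h₂
    · exact le_rfl
    · exact absurd (himp h₁) h₂
    · exact zero_le_one
    · exact le_rfl
  refine (Finset.expect_le_expect fun ν _ => hpoint ν).trans (le_of_eq ?_)
  rw [Finset.expect_add_distrib]
  congr 1
  · exact Fintype.expect_equiv e _ _ fun ν => rfl
  · rw [expect_pi_apply j fun a : Fin N => if a = ⟨N - 1, by omega⟩ then (1 : ℝ) else 0,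
      Fintype.expect_eq_sum_div_card]
    simp

variable {α : Type*} [Fintype α] [Nonempty α]

/-- The keys of the samples `x`: their scores, perturbed by the noise `ν`. -/
def noisyKeys (F : α → ℕ) (x : Fin k → α) (ν : Fin k → Fin N) : Fin k → ℕ :=
  fun j => F (x j) + ν j

variable (k N)

/-- The expected value of `φ` at a random one of the `L` leading samples. -/
noncomputable def leaderMean (L : ℕ) (F : α → ℕ) (φ : α → ℝ) : ℝ :=
  𝔼 x : Fin k → α, 𝔼 ν : Fin k → Fin N, (∑ j ∈ topItems L (noisyKeys F x ν), φ (x j)) / L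

/-- The expected average key of the `L` leading samples. -/
noncomputable def leaderKey (L : ℕ) (F : α → ℕ) : ℝ :=
  𝔼 x : Fin k → α, 𝔼 ν : Fin k → Fin N,
    (∑ j ∈ topItems L (noisyKeys F x ν), (noisyKeys F x ν j : ℝ)) / L

variable {k N} {L : ℕ}

lemma leaderKey_zero_le (hL : L ≤ k) (hL₀ : 0 < L) :
    leaderKey k N L (fun _ : α => 0) ≤ N := by
  refine (Finset.expect_le_expect (g := fun _ => (N : ℝ)) fun x _ =>
    (Finset.expect_le_expect (g := fun _ => (N : ℝ)) fun ν _ => ?_).trans ?_).trans ?_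
  · rw [div_le_iff₀ (by exact_mod_cast hL₀)]
    calc _ ≤ ∑ j ∈ topItems L (noisyKeys (fun _ => 0) x ν), (N : ℝ) := by
          refine Finset.sum_le_sum fun j _ => ?_
          simp only [noisyKeys, zero_add]
          exact_mod_cast (ν j).2.le
      _ = N * L := by rw [Finset.sum_const, card_topItems hL, nsmul_eq_mul, mul_comm]
  · rw [Fintype.expect_const]
  · rw [Fintype.expect_const]

/-- Split the new leaders' keys into old keys and the gain from `d`. The old leaders have at least
as large an old-key sum; stability lets the gain be measured on the old leaders, at a loss of `1 /
N` per sample. -/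
lemma leaderKey_add_le (hL : L ≤ k) (hL₀ : 0 < L) (F : α → ℕ) (d : α → Bool) :
    leaderKey k N L (fun a => F a + (d a).toNat) ≤
      leaderKey k N L F + leaderMean k N L F (fun a => (d a).toNat) + k / (L * N) := by
  have hL' : (0 : ℝ) < L := by exact_mod_cast hL₀
  have hN' : (0 : ℝ) < N := by exact_mod_cast Nat.pos_of_neZero N
  unfold leaderKey leaderMean
  rw [← Finset.expect_add_distrib, ← Fintype.expect_const (ι := Fin k → α) ((k : ℝ) / (L * N)),
    ← Finset.expect_add_distrib]
  refine Finset.expect_le_expect fun x _ => ?_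
  set F' : α → ℕ := fun a => F a + (d a).toNat with hF'
  have hkeys : ∀ ν : Fin k → Fin N, ∀ j,
      (noisyKeys F' x ν j : ℝ) = noisyKeys F x ν j + (d (x j)).toNat := by
    intro ν j
    simp only [noisyKeys, hF']
    push_cast
    ring
  have h₁ : 𝔼 ν : Fin k → Fin N,
      (∑ j ∈ topItems L (noisyKeys F' x ν), (noisyKeys F' x ν j : ℝ)) / L ≤
      𝔼 ν : Fin k → Fin N, (∑ j ∈ topItems L (noisyKeys F x ν), (noisyKeys F x ν j : ℝ)) / L +
      𝔼 ν : Fin k → Fin N, (∑ j ∈ topItems L (noisyKeys F' x ν), ((d (x j)).toNat : ℝ)) / L := by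
    rw [← Finset.expect_add_distrib]
    refine Finset.expect_le_expect fun ν _ => ?_
    rw [← add_div]
    refine div_le_div_of_nonneg_right ?_ hL'.le
    simp only [hkeys, Finset.sum_add_distrib]
    exact add_le_add_left (sum_le_sum_topItems hL _ _ (card_topItems hL _).le) _
  have hswap : ∀ G : α → ℕ,
      𝔼 ν : Fin k → Fin N, (∑ j ∈ topItems L (noisyKeys G x ν), ((d (x j)).toNat : ℝ)) / L =
      (∑ j, ((d (x j)).toNat : ℝ) * 𝔼 ν : Fin k → Fin N,
        (if j ∈ topItems L (fun i => G (x i) + ν i) then (1 : ℝ) else 0)) / L := by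
    intro G
    rw [← Finset.expect_div]
    simp_rw [Finset.mul_expect]
    rw [← Finset.expect_sum_comm]
    congr 1
    refine Finset.expect_congr rfl fun ν _ => ?_
    simp only [mul_ite, mul_one, mul_zero, ← Finset.sum_filter]
    congr 1
    ext j
    simp only [Finset.mem_filter, Finset.mem_univ, true_and]
    rfl
  have h₂ : 𝔼 ν : Fin k → Fin N,
      (∑ j ∈ topItems L (noisyKeys F' x ν), ((d (x j)).toNat : ℝ)) / L ≤
      𝔼 ν : Fin k → Fin N, (∑ j ∈ topItems L (noisyKeys F x ν), ((d (x j)).toNat : ℝ)) / L +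
        k / (L * N) := by
    rw [hswap, hswap, mul_comm (L : ℝ), ← div_div, ← add_div]
    gcongr
    have : (k : ℝ) / N = ∑ _j : Fin k, 1 / (N : ℝ) := by
      simp [div_eq_mul_inv]
    rw [this, ← Finset.sum_add_distrib]
    refine Finset.sum_le_sum fun j _ => ?_
    have hd : ((d (x j)).toNat : ℝ) ≤ 1 := by exact_mod_cast Bool.toNat_le _
    have hd₀ : (0 : ℝ) ≤ ((d (x j)).toNat : ℝ) := Nat.cast_nonneg _
    have := expect_mem_topItems_le (N := N) (L := L) (u := fun i => F (x i))
      (v := fun i => F' (x i)) (fun i => Nat.le_add_right _ _)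
      (fun i => Nat.add_le_add_left (Bool.toNat_le _) _) j
    have h1 : (0 : ℝ) ≤ 1 / N := by positivity
    nlinarith [mul_le_mul_of_nonneg_left this hd₀]
  linarith

/-- The weights imitating `p` are a feasible fractional choice, so the leaders do at least as well;
the noise is nonnegative and can be dropped. -/
lemma sub_le_leaderKey {K h : ℕ} (hK : 0 < K) (hh : 0 < h) (p : α → ℝ)
    (hp₀ : ∀ a, 0 ≤ p a) (hp : ∑ a, p a = 1) (hpK : ∀ a, p a * Fintype.card α ≤ K)
    (F : α → ℕ) (t : ℕ) (hF : ∀ a, F a ≤ t) :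
    ∑ a, p a * F a - t / h ≤ leaderKey (K * h ^ 2) N (h ^ 2) F := by
  obtain ⟨c, hc₀, hc₁, hc, hcφ⟩ := exists_weights hK hh rfl p hp₀ hp hpK
  have hh' : (0 : ℝ) < h := by exact_mod_cast hh
  have hL : h ^ 2 ≤ K * h ^ 2 := Nat.le_mul_of_pos_left _ hK
  have h₁ := hcφ t (fun a => F a) (fun a => Nat.cast_nonneg _) (fun a => by exact_mod_cast hF a)
  calc ∑ a, p a * F a - t / h = ((h : ℝ) ^ 2 * ∑ a, p a * F a - t * h) / (h ^ 2 : ℕ) := by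
        push_cast
        field_simp
    _ ≤ (𝔼 x, ∑ j, c x j * (F (x j) : ℝ)) / (h ^ 2 : ℕ) := by gcongr
    _ ≤ _ := by
        rw [Finset.expect_div]
        refine Finset.expect_le_expect fun x _ => ?_
        rw [← Fintype.expect_const (ι := Fin (K * h ^ 2) → Fin N)
          ((∑ j, c x j * (F (x j) : ℝ)) / (h ^ 2 : ℕ))]
        refine Finset.expect_le_expect fun ν _ => ?_
        gcongr
        refine le_trans ?_ (sum_mul_le_sum_topItems hL _ (c x) (hc₀ x) (hc₁ x) (hc x))
        refine Finset.sum_le_sum fun j _ => mul_le_mul_of_nonneg_left ?_ (hc₀ x j)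
        simp [noisyKeys]

/-- The number of tests from a list that accept. -/
def score {τ : Type*} (ev : τ → α → Bool) (ds : List τ) (a : α) : ℕ :=
  (ds.map fun d => (ev d a).toNat).sum

omit [Fintype α] [Nonempty α] in
lemma score_le_length {τ : Type*} (ev : τ → α → Bool) (ds : List τ) (a : α) :
    score ev ds a ≤ ds.length := by
  induction ds with
  | nil => simp [score]
  | cons d ds ih =>
    simp only [score, List.map_cons, List.sum_cons, List.length_cons] at *
    have := Bool.toNat_le (ev d a)
    omega

/-- Boosting: some short list of tests makes the perturbed leader indistinguishable from `p` for
all tests. -/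
theorem exists_list_forall_le {β τ : Type*} [Fintype β] {K h T : ℕ} (hK : 0 < K) (hh : 0 < h)
    {ε : ℝ} (hT : N + T * (K / N + 1 / h) < T * ε) (μ : β → ℝ) (hμ₀ : ∀ z, 0 ≤ μ z)
    (hμ : ∑ z, μ z = 1) (p : β → α → ℝ) (hp₀ : ∀ z a, 0 ≤ p z a)
    (hp : ∀ z, μ z ≠ 0 → ∑ a, p z a = 1)
    (hpK : ∀ z, μ z ≠ 0 → ∀ a, p z a * Fintype.card α ≤ K) (ev : β → τ → α → Bool) :
    ∃ ds : List τ, ds.length < T ∧ ∀ d,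
      ∑ z, μ z * ∑ a, p z a * (ev z d a).toNat -
        ∑ z, μ z * leaderMean (K * h ^ 2) N (h ^ 2) (score (ev z) ds)
          (fun a => (ev z d a).toNat) ≤ ε := by
  by_contra hcon
  push Not at hcon
  have hL : h ^ 2 ≤ K * h ^ 2 := Nat.le_mul_of_pos_left _ hK
  have hL₀ : 0 < h ^ 2 := by positivity
  -- If no list works, there is always a test to append, and each one lowers the potential by at
  -- least `ε - K / N`.
  have hpot : ∀ t ≤ T, ∃ ds : List τ, ds.length = t ∧
      ∑ z, μ z * (leaderKey (K * h ^ 2) N (h ^ 2) (score (ev z) ds) -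
        ∑ a, p z a * score (ev z) ds a) ≤ N + t * (K / N - ε) := by
    intro t
    induction t with
    | zero =>
      refine fun _ => ⟨[], rfl, ?_⟩
      calc _ ≤ ∑ z, μ z * (N : ℝ) := by
            refine Finset.sum_le_sum fun z _ => mul_le_mul_of_nonneg_left ?_ (hμ₀ z)
            have := leaderKey_zero_le (α := α) (N := N) hL hL₀
            have h0 : ∑ a, p z a * (score (ev z) ([] : List τ) a : ℝ) = 0 := by simp [score]
            rw [h0, sub_zero]
            exact this
        _ = _ := by rw [← Finset.sum_mul, hμ]; simp
    | succ t ih =>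
      intro ht
      obtain ⟨ds, hlen, hds⟩ := ih (by omega)
      obtain ⟨d, hd⟩ := hcon ds (by omega)
      refine ⟨d :: ds, by simp [hlen], ?_⟩
      have hcons : ∀ z, score (ev z) (d :: ds) =
          fun a => score (ev z) ds a + (ev z d a).toNat := by
        intro z
        ext a
        simp [score, add_comm]
      have hstep : ∀ z, μ z * (leaderKey (K * h ^ 2) N (h ^ 2) (score (ev z) (d :: ds)) -
          ∑ a, p z a * score (ev z) (d :: ds) a) ≤
          μ z * (leaderKey (K * h ^ 2) N (h ^ 2) (score (ev z) ds) -
            ∑ a, p z a * score (ev z) ds a) +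
          μ z * leaderMean (K * h ^ 2) N (h ^ 2) (score (ev z) ds)
            (fun a => (ev z d a).toNat) -
          μ z * ∑ a, p z a * (ev z d a).toNat + μ z * (K / N) := by
        intro z
        rw [← mul_add, ← mul_sub, ← mul_add]
        refine mul_le_mul_of_nonneg_left ?_ (hμ₀ z)
        have h₁ := leaderKey_add_le (N := N) hL hL₀ (score (ev z) ds) (ev z d)
        have h₂ : (((K * h ^ 2 : ℕ) : ℝ) / ((h ^ 2 : ℕ) * N)) = K / N := by
          push_cast
          rw [mul_comm (K : ℝ), mul_div_mul_left _ _ (by positivity)]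
        rw [h₂] at h₁
        rw [hcons]
        have h₃ : ∑ a, p z a * ((score (ev z) ds a + (ev z d a).toNat : ℕ) : ℝ) =
            ∑ a, p z a * score (ev z) ds a + ∑ a, p z a * (ev z d a).toNat := by
          rw [← Finset.sum_add_distrib]
          exact Finset.sum_congr rfl fun a _ => by push_cast; ring
        rw [h₃]
        linarith
      refine (Finset.sum_le_sum fun z _ => hstep z).trans ?_
      rw [Finset.sum_add_distrib, Finset.sum_sub_distrib, Finset.sum_add_distrib,
        ← Finset.sum_mul, hμ]
      push_cast
      linarith
  obtain ⟨ds, hlen, hds⟩ := hpot T le_rfl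
  have hlow : -(T / h : ℝ) ≤ ∑ z, μ z * (leaderKey (K * h ^ 2) N (h ^ 2) (score (ev z) ds) -
        ∑ a, p z a * score (ev z) ds a) := by
    calc -(T / h : ℝ) = ∑ z, μ z * -(T / h : ℝ) := by rw [← Finset.sum_mul, hμ, one_mul]
      _ ≤ _ := by
        refine Finset.sum_le_sum fun z _ => ?_
        rcases eq_or_ne (μ z) 0 with hz | hz
        · simp [hz]
        refine mul_le_mul_of_nonneg_left ?_ (hμ₀ z)
        have := sub_le_leaderKey (N := N) hK hh (p z) (hp₀ z) (hp z hz) (hpK z hz)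
          (score (ev z) ds) T (fun a => hlen ▸ score_le_length _ _ _)
        linarith
  have : (T : ℝ) * (K / N + 1 / h) = T * (K / N) + T / h := by ring
  have : (T : ℝ) * (K / N - ε) = T * (K / N) - T * ε := by ring
  linarith

/-- Union bound: count all samples equal to `a`, leading or not. -/
lemma leaderMean_indicator_le [DecidableEq α] (hL₀ : 0 < L) (F : α → ℕ) (a : α) :
    leaderMean k N L F (fun b => if b = a then 1 else 0) ≤ k / (L * Fintype.card α) := by
  have hL' : (0 : ℝ) < L := by exact_mod_cast hL₀
  calc leaderMean k N L F (fun b => if b = a then 1 else 0)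
      ≤ 𝔼 x : Fin k → α, 𝔼 ν : Fin k → Fin N, (∑ j, if x j = a then (1 : ℝ) else 0) / L := by
        refine Finset.expect_le_expect fun x _ => Finset.expect_le_expect fun ν _ => ?_
        refine div_le_div_of_nonneg_right ?_ hL'.le
        refine Finset.sum_le_univ_sum_of_nonneg fun j => ?_
        dsimp only
        split_ifs <;> simp
    _ = k / (L * Fintype.card α) := by
        simp_rw [Fintype.expect_const, ← Finset.expect_div, Finset.expect_sum_comm]
        simp_rw [expect_pi_apply (ι := Fin k) _ fun b : α => if b = a then (1 : ℝ) else 0]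
        rw [Fintype.expect_eq_sum_div_card]
        simp
        field_simp

end PerturbedLeader

/-! ### Gate counts for binary arithmetic -/

section CircuitCost

variable {q κ : ℕ} {Q : Set (Bits q → Bool)}

/-- The functions computed on the wires of a circuit. -/
def Circuit.wires {t : ℕ} (c : Circuit Q κ t) : Set (Bits κ → Bool) :=
  {f | ∃ o, ∀ x, c.eval x o = f x}

lemma Circuit.wires_subset_snoc {t : ℕ} (c : Circuit Q κ t) (g : Gate Q (κ + t)) :
    c.wires ⊆ (c.snoc g).wires := by
  rintro f ⟨o, ho⟩
  exact ⟨Fin.castSucc o, fun x => (Fin.snoc_castSucc (α := fun _ => Bool) _ _ _).trans (ho x)⟩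

lemma Circuit.val_mem_wires_snoc {t : ℕ} (c : Circuit Q κ t) (g : Gate Q (κ + t)) :
    (fun x => g.val (c.eval x)) ∈ (c.snoc g).wires :=
  ⟨Fin.last _, fun _ => Fin.snoc_last (α := fun _ => Bool) _ _⟩

variable (Q) in
/-- Any circuit with the functions in `A` on its wires extends, with at most `n` further gates, to
one that also has the functions in `B`. -/
def Cost (A : Set (Bits κ → Bool)) (n : ℕ) (B : Set (Bits κ → Bool)) : Prop :=
  ∀ (t : ℕ) (c : Circuit Q κ t), A ⊆ c.wires →
    ∃ t' ≤ t + n, ∃ c' : Circuit Q κ t', c.wires ⊆ c'.wires ∧ B ⊆ c'.wires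

namespace Cost

variable {A A' B B' C : Set (Bits κ → Bool)} {n n' : ℕ} {f g : Bits κ → Bool}

lemma of_subset (h : B ⊆ A) : Cost Q A n B := fun t c hc =>
  ⟨t, Nat.le_add_right _ _, c, subset_rfl, h.trans hc⟩

lemma mono (h : Cost Q A n B) (hA : A ⊆ A') (hn : n ≤ n') (hB : B' ⊆ B) : Cost Q A' n' B' := by
  intro t c hc
  obtain ⟨t', ht', c', h₁, h₂⟩ := h t c (hA.trans hc)
  exact ⟨t', ht'.trans (Nat.add_le_add_left hn _), c', h₁, hB.trans h₂⟩

lemma trans (h : Cost Q A n B) (h' : Cost Q (A ∪ B) n' C) : Cost Q A (n + n') (B ∪ C) := by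
  intro t c hc
  obtain ⟨t₁, ht₁, c₁, h₁, h₂⟩ := h t c hc
  obtain ⟨t₂, ht₂, c₂, h₃, h₄⟩ := h' t₁ c₁ (Set.union_subset (hc.trans h₁) h₂)
  exact ⟨t₂, by omega, c₂, h₁.trans h₃, Set.union_subset (h₂.trans h₃) h₄⟩

lemma comp (h : Cost Q A n B) (h' : Cost Q (A ∪ B) n' C) : Cost Q A (n + n') C :=
  (h.trans h').mono subset_rfl le_rfl Set.subset_union_right

lemma union (h : Cost Q A n B) (h' : Cost Q A n' C) : Cost Q A (n + n') (B ∪ C) :=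
  h.trans (h'.mono Set.subset_union_left le_rfl subset_rfl)

lemma iUnion_fin {r : ℕ} {B : Fin r → Set (Bits κ → Bool)} (h : ∀ i, Cost Q A n (B i)) :
    Cost Q A (r * n) (⋃ i, B i) := by
  induction r with
  | zero => exact of_subset (by simp)
  | succ r ih =>
    refine ((ih fun i => h i.castSucc).union (h (Fin.last r))).mono subset_rfl
      (by rw [Nat.succ_mul]) ?_
    refine Set.iUnion_subset fun i => ?_
    refine Fin.lastCases ?_ (fun j => ?_) i
    · exact Set.subset_union_right
    · exact (Set.subset_iUnion (fun j : Fin r => B j.castSucc) j).trans Set.subset_union_left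

lemma const (b : Bool) : Cost Q A 1 {fun _ => b} := fun t c _ =>
  ⟨t + 1, le_rfl, c.snoc (.const b), c.wires_subset_snoc _,
    Set.singleton_subset_iff.2 (c.val_mem_wires_snoc (.const b))⟩

lemma binary (op : Bool → Bool → Bool) (hf : Cost Q A n {f}) (hg : Cost Q A n' {g}) :
    Cost Q A (n + n' + 1) {fun x => op (f x) (g x)} := by
  refine (hf.union hg).comp fun t c hc => ?_
  obtain ⟨i, hi⟩ := hc (.inr (.inl rfl) : f ∈ A ∪ ({f} ∪ {g}))
  obtain ⟨j, hj⟩ := hc (.inr (.inr rfl) : g ∈ A ∪ ({f} ∪ {g}))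
  refine ⟨t + 1, le_rfl, c.snoc (.binary op i j), c.wires_subset_snoc _,
    Set.singleton_subset_iff.2 ?_⟩
  convert c.val_mem_wires_snoc (.binary op i j) using 2 with x
  simp [Gate.val, hi, hj]

lemma of_mem (h : f ∈ A) : Cost Q A 0 {f} := of_subset (Set.singleton_subset_iff.2 h)

lemma query {D : Bits q → Bool} (hD : D ∈ Q) {args : Fin q → Bits κ → Bool}
    (h : ∀ a, args a ∈ A) : Cost Q A 1 {fun x => D fun a => args a x} := by
  intro t c hc
  choose o ho using fun a => hc (h a)
  refine ⟨t + 1, le_rfl, c.snoc (.query D hD o), c.wires_subset_snoc _,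
    Set.singleton_subset_iff.2 ?_⟩
  convert c.val_mem_wires_snoc (.query D hD o) using 2 with x
  simp [Gate.val, ho]

end Cost

/-- The `b` low-order bits of a number depending on the input. -/
def bitsOf (b : ℕ) (v : Bits κ → ℕ) : Set (Bits κ → Bool) :=
  {f | ∃ i < b, f = fun x => (v x).testBit i}

lemma testBit_mem_bitsOf {b i : ℕ} (hi : i < b) (v : Bits κ → ℕ) :
    (fun x => (v x).testBit i) ∈ bitsOf b v := ⟨i, hi, rfl⟩

/-- The carry into position `i` when `d` is added to `v`. -/
def incCarry (v : ℕ) (d : Bool) : ℕ → Bool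
  | 0 => d
  | i + 1 => v.testBit i && incCarry v d i

lemma incCarry_succ' (v : ℕ) (d : Bool) (i : ℕ) :
    incCarry v d (i + 1) = incCarry (v / 2) (v.testBit 0 && d) i := by
  induction i with
  | zero => rfl
  | succ i ih => rw [incCarry, ih, incCarry, Nat.testBit_succ]

lemma testBit_add_toNat (v : ℕ) (d : Bool) (i : ℕ) :
    (v + d.toNat).testBit i = (v.testBit i ^^ incCarry v d i) := by
  induction i generalizing v d with
  | zero =>
    simp only [Nat.testBit_zero, incCarry]
    cases d
    · simp
    · rcases Nat.mod_two_eq_zero_or_one v with h | h <;> simp [Nat.add_mod, h]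
  | succ i ih =>
    rw [Nat.testBit_succ, Nat.testBit_succ, incCarry_succ', ← ih]
    congr 1
    cases d
    · simp
    · rcases Nat.mod_two_eq_zero_or_one v with h | h <;> simp [h] <;> omega

variable {A : Set (Bits κ → Bool)} {n : ℕ}

/-- Ripple carry: one `and` for the carry and one `xor` for the digit at each position. -/
lemma Cost.increment {b : ℕ} {v : Bits κ → ℕ} {d : Bits κ → Bool} (hv : bitsOf b v ⊆ A)
    (hd : d ∈ A) : Cost Q A (2 * b) (bitsOf b fun x => v x + (d x).toNat) := by
  have h : ∀ i ≤ b, Cost Q A (2 * i)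
      ({fun x => incCarry (v x) (d x) i} ∪ bitsOf i fun x => v x + (d x).toNat) := by
    intro i
    induction i with
    | zero =>
      refine fun _ => Cost.of_subset (Set.union_subset (Set.singleton_subset_iff.2 hd) ?_)
      rintro f ⟨i, hi, -⟩
      omega
    | succ i ih =>
      intro hi
      have hvi : (fun x => (v x).testBit i) ∈ A := hv (testBit_mem_bitsOf (by omega) v)
      have hcarry := Cost.binary (Q := Q) (A := A ∪
        ({fun x => incCarry (v x) (d x) i} ∪ bitsOf i fun x => v x + (d x).toNat)) and
        (Cost.of_mem (.inl hvi)) (Cost.of_mem (.inr (.inl rfl)))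
      have hbit := Cost.binary (Q := Q) (A := A ∪
        ({fun x => incCarry (v x) (d x) i} ∪ bitsOf i fun x => v x + (d x).toNat)) xor
        (Cost.of_mem (.inl hvi)) (Cost.of_mem (.inr (.inl rfl)))
      refine ((ih (by omega)).trans (hcarry.union hbit)).mono subset_rfl (by omega) ?_
      rintro f (rfl | ⟨j, hj, rfl⟩)
      · exact .inr (.inl rfl)
      · rcases Nat.lt_succ_iff_lt_or_eq.1 hj with hj | rfl
        · exact .inl (.inr ⟨j, hj, rfl⟩)
        · exact .inr (.inr (funext fun x => testBit_add_toNat _ _ _))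
  exact (h b le_rfl).mono subset_rfl le_rfl Set.subset_union_right

/-- A counter with initial value `v`. Starting it at the noise yields the noisy key with no separate
addition. -/
lemma Cost.addCount {b : ℕ} (l : List (Bits κ → Bool)) (hl : ∀ d ∈ l, Cost Q A n {d})
    {v : Bits κ → ℕ} (hv : bitsOf b v ⊆ A) :
    Cost Q A (l.length * (n + 2 * b))
      (bitsOf b fun x => (l.map fun d => (d x).toNat).sum + v x) := by
  induction l with
  | nil => exact Cost.of_subset (by simpa using hv)
  | cons d l ih =>
    have ih := ih fun d' hd' => hl d' (List.mem_cons_of_mem _ hd')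
    refine (ih.comp (((hl d List.mem_cons_self).mono Set.subset_union_left le_rfl
      subset_rfl).comp (Cost.increment (Q := Q) (b := b)
        (v := fun x => (l.map fun d => (d x).toNat).sum + v x) (d := d) ?_ ?_))).mono
      subset_rfl ?_ ?_
    · exact Set.subset_union_right.trans Set.subset_union_left
    · exact .inr rfl
    · exact (Nat.succ_mul _ _).ge
    · simp only [List.map_cons, List.sum_cons]
      rintro f ⟨i, hi, rfl⟩
      exact ⟨i, hi, funext fun x => by dsimp only; congr 1; omega⟩

lemma mod_two_pow_succ_lt_iff (u v i : ℕ) :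
    decide (u % 2 ^ (i + 1) < v % 2 ^ (i + 1)) =
      ((!u.testBit i && v.testBit i) ||
        (!(u.testBit i ^^ v.testBit i) && decide (u % 2 ^ i < v % 2 ^ i))) := by
  have hu := Nat.mod_lt u (Nat.two_pow_pos i)
  have hv := Nat.mod_lt v (Nat.two_pow_pos i)
  rw [Nat.mod_pow_succ, Nat.mod_pow_succ, ← Nat.toNat_testBit, ← Nat.toNat_testBit]
  cases u.testBit i <;> cases v.testBit i <;> simp <;> omega

lemma Cost.lt {b : ℕ} {u v : Bits κ → ℕ} (hu : bitsOf b u ⊆ A) (hv : bitsOf b v ⊆ A) :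
    Cost Q A (4 * b + 1) {fun x => decide (u x % 2 ^ b < v x % 2 ^ b)} := by
  have h : ∀ i ≤ b, Cost Q A (4 * i + 1) {fun x => decide (u x % 2 ^ i < v x % 2 ^ i)} := by
    intro i
    induction i with
    | zero => exact fun _ => by simpa [Nat.mod_one] using Cost.const (Q := Q) (A := A) false
    | succ i ih =>
      intro hi
      have hui := Cost.of_mem (Q := Q) (hu (testBit_mem_bitsOf (by omega : i < b) u))
      have hvi := Cost.of_mem (Q := Q) (hv (testBit_mem_bitsOf (by omega : i < b) v))
      have := Cost.binary or (Cost.binary (fun p r => !p && r) hui hvi)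
        (Cost.binary (fun p r => !p && r) (Cost.binary xor hui hvi) (ih (by omega)))
      simp only [mod_two_pow_succ_lt_iff]
      exact this.mono subset_rfl (by omega) subset_rfl
  exact h b le_rfl

lemma mod_two_pow_succ_eq_iff (u v i : ℕ) :
    decide (u % 2 ^ (i + 1) = v % 2 ^ (i + 1)) =
      (!(u.testBit i ^^ v.testBit i) && decide (u % 2 ^ i = v % 2 ^ i)) := by
  have hu := Nat.mod_lt u (Nat.two_pow_pos i)
  have hv := Nat.mod_lt v (Nat.two_pow_pos i)
  rw [Nat.mod_pow_succ, Nat.mod_pow_succ, ← Nat.toNat_testBit, ← Nat.toNat_testBit]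
  cases u.testBit i <;> cases v.testBit i <;> simp <;> omega

lemma Cost.eq {b : ℕ} {u v : Bits κ → ℕ} (hu : bitsOf b u ⊆ A) (hv : bitsOf b v ⊆ A) :
    Cost Q A (2 * b + 1) {fun x => decide (u x % 2 ^ b = v x % 2 ^ b)} := by
  have h : ∀ i ≤ b, Cost Q A (2 * i + 1) {fun x => decide (u x % 2 ^ i = v x % 2 ^ i)} := by
    intro i
    induction i with
    | zero => exact fun _ => by simpa [Nat.mod_one] using Cost.const (Q := Q) (A := A) true
    | succ i ih =>
      intro hi
      have hui := Cost.of_mem (Q := Q) (hu (testBit_mem_bitsOf (by omega : i < b) u))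
      have hvi := Cost.of_mem (Q := Q) (hv (testBit_mem_bitsOf (by omega : i < b) v))
      have := Cost.binary (fun p r => !p && r) (Cost.binary xor hui hvi) (ih (by omega))
      simp only [mod_two_pow_succ_eq_iff]
      exact this.mono subset_rfl (by omega) subset_rfl
  exact h b le_rfl

lemma Cost.exists_fin {r : ℕ} {g : Fin r → Bits κ → Bool} (h : ∀ j, Cost Q A n {g j}) :
    Cost Q A (r * (n + 1) + 1) {fun x => decide (∃ j, g j x = true)} := by
  induction r with
  | zero => simpa using Cost.const (Q := Q) (A := A) false
  | succ r ih =>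
    have := Cost.binary or (ih fun j => h j.succ) (h 0)
    refine this.mono subset_rfl (by ring_nf; omega) ?_
    rw [Set.singleton_subset_iff, Set.mem_singleton_iff]
    ext x
    simp only [Fin.exists_fin_succ, Bool.decide_or, Bool.decide_eq_true]
    exact Bool.or_comm _ _

end CircuitCost

/-! ### The simulator as a circuit -/

section Simulator

/-- Bit strings as numbers in binary. -/
def bitsEquivFin (c : ℕ) : Bits c ≃ Fin (2 ^ c) where
  toFun f := ⟨Nat.ofBits f, Nat.ofBits_lt_two_pow f⟩
  invFun v i := (v : ℕ).testBit i
  left_inv f := by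
    ext i
    simp [Nat.testBit_ofBits_lt]
  right_inv v := by
    ext
    simp [Nat.ofBits_testBit, Nat.mod_eq_of_lt v.2]

/-- The indices of the random bits: samples, noise, and position of the output. -/
def coinEquiv (k n c a : ℕ) :
    (Fin k × Fin n) ⊕ ((Fin k × Fin c) ⊕ Fin a) ≃ Fin (k * n + (k * c + a)) :=
  (Equiv.sumCongr finProdFinEquiv
    ((Equiv.sumCongr finProdFinEquiv (Equiv.refl _)).trans finSumFinEquiv)).trans finSumFinEquiv

/-- The random bits read as samples, noise, and position of the output. -/
def parseCoins (k n c a : ℕ) :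
    Bits (k * n + (k * c + a)) ≃ (Fin k → Bits n) × (Fin k → Fin (2 ^ c)) × Fin (2 ^ a) :=
  (Equiv.arrowCongr (coinEquiv k n c a).symm (Equiv.refl Bool)).trans <|
    (Equiv.sumArrowEquivProdArrow _ _ _).trans <|
      Equiv.prodCongr (Equiv.curry _ _ _) <|
        (Equiv.sumArrowEquivProdArrow _ _ _).trans <|
          Equiv.prodCongr
            ((Equiv.curry _ _ _).trans (Equiv.arrowCongr (Equiv.refl _) (bitsEquivFin c)))
            (bitsEquivFin a)

variable {k n c a : ℕ}

/-- The sample at position `r` in the order by decreasing key. -/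
def pick (x : Fin k → Bits n) (u : Fin k → ℕ) (r : ℕ) : Bits n :=
  fun i => decide (∃ j, (decide (keyRank u j = r) && x j i) = true)

/-- Ranks form a permutation, so exactly one term of the disjunction is switched on. -/
lemma pick_eq (x : Fin k → Bits n) (u : Fin k → ℕ) (r : Fin k) :
    pick x u r = x ((rankEquiv u).symm r) := by
  ext i
  rw [pick, Bool.eq_iff_iff, decide_eq_true_iff]
  constructor
  · rintro ⟨j, hj⟩
    rw [Bool.and_eq_true, decide_eq_true_iff] at hj
    have : (rankEquiv u).symm r = j := by
      rw [Equiv.symm_apply_eq]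
      exact Fin.ext hj.1.symm
    rw [this]
    exact hj.2
  · intro h
    exact ⟨(rankEquiv u).symm r, by simp [keyRank_rankEquiv_symm, h]⟩

/-- As `L` and the noise range are powers of two, the coins parse bijectively and the simulation is
exact. -/
lemma expect_parseCoins {L : ℕ} (hL : L = 2 ^ a) (hLk : L ≤ k) (F : Bits n → ℕ) (φ : Bits n → ℝ) :
    𝔼 ρ, φ (pick (parseCoins k n c a ρ).1
        (noisyKeys F (parseCoins k n c a ρ).1 (parseCoins k n c a ρ).2.1)
        (parseCoins k n c a ρ).2.2) = leaderMean k (2 ^ c) L F φ := by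
  subst hL
  rw [Fintype.expect_equiv (parseCoins k n c a) _
    (fun w => φ (pick w.1 (noisyKeys F w.1 w.2.1) w.2.2)) fun _ => rfl,
    ← Finset.univ_product_univ, Finset.expect_product]
  refine Finset.expect_congr rfl fun x _ => ?_
  rw [← Finset.univ_product_univ, Finset.expect_product]
  refine Finset.expect_congr rfl fun ν _ => ?_
  rw [sum_topItems hLk, Fintype.expect_eq_sum_div_card, Fintype.card_fin]
  congr 1
  refine Finset.sum_congr rfl fun r _ => ?_
  exact congrArg φ (pick_eq x (noisyKeys F x ν) (Fin.castLE hLk r))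

variable {κ m : ℕ} {Q : Set (Bits (n + m) → Bool)}

variable (Q) in
/-- The members of a class of Boolean functions and their negations. -/
abbrev SignedTest : Type := {d : Bits (n + m) → Bool // d ∈ Q ∨ (fun x => !d x) ∈ Q}

/-- A test evaluated on a pair. -/
def SignedTest.ev (z : Bits m) (d : SignedTest Q) (x : Bits n) : Bool := d.1 (Fin.append x z)

variable {A : Set (Bits κ → Bool)}

lemma Cost.signedTest (d : SignedTest Q) {args : Fin (n + m) → Bits κ → Bool}
    (h : ∀ i, args i ∈ A) : Cost Q A 3 {fun x => d.1 fun i => args i x} := by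
  rcases d.2 with hd | hd
  · exact (Cost.query hd h).mono subset_rfl (by omega) subset_rfl
  -- Negation is a binary gate ignoring its second argument; `Cost.binary` charges for the query
  -- twice, hence the 3.
  · have := Cost.binary (fun p _ => !p) (Cost.query hd h) (Cost.query hd h)
    simpa using this

lemma Cost.beats {b : ℕ} {u : Bits κ → Fin k → ℕ} (hu : ∀ j, bitsOf b (fun x => u x j) ⊆ A)
    (hb : ∀ x j, u x j < 2 ^ b) (i j : Fin k) :
    Cost Q A (8 * b + 3) {fun x => beats (u x) i j} := by
  have hlt : ∀ i j, Cost Q A (4 * b + 1) {fun x => decide (u x i < u x j)} := by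
    intro i j
    have := Cost.lt (Q := Q) (hu i) (hu j)
    simpa only [Nat.mod_eq_of_lt (hb _ _)] using this
  by_cases hij : i < j
  · have := Cost.binary (fun p _ => !p) (hlt i j) (hlt i j)
    refine this.mono subset_rfl (by omega) ?_
    simp only [_root_.beats, hij, if_true, Set.singleton_subset_iff, Set.mem_singleton_iff]
    ext w
    rw [← decide_not, decide_eq_decide, not_lt]
  · simp only [_root_.beats, hij, if_false]
    exact (hlt j i).mono subset_rfl (by omega) subset_rfl

lemma bitsOf_ofBits_subset {b c : ℕ} {f : Fin c → Bits κ → Bool} (hf : ∀ i, f i ∈ A)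
    (h₀ : (fun _ => false) ∈ A) : bitsOf b (fun x => Nat.ofBits fun i => f i x) ⊆ A := by
  rintro g ⟨i, -, rfl⟩
  by_cases hi : i < c
  · simpa only [Nat.testBit_ofBits_lt _ _ hi] using hf ⟨i, hi⟩
  · simpa only [Nat.testBit_ofBits_ge _ _ (not_lt.1 hi)] using h₀

/-- The cost of computing the sample at a given position in the order by noisy scores. -/
lemma Cost.pick {b : ℕ} (ds : List (SignedTest Q)) {z : Fin m → Bits κ → Bool}
    {x : Fin k → Fin n → Bits κ → Bool} {ν : Fin k → Bits κ → ℕ} {r : Bits κ → ℕ}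
    (hz : ∀ i, z i ∈ A) (hx : ∀ j i, x j i ∈ A) (hν : ∀ j, bitsOf b (ν j) ⊆ A)
    (hr : bitsOf b r ⊆ A) (h₀ : (fun _ => false) ∈ A) (hνb : ∀ w j, ds.length + ν j w < 2 ^ b)
    (hk : k ≤ 2 ^ b) (hrb : ∀ w, r w < 2 ^ b) :
    Cost Q A (k * (ds.length * (3 + 2 * b)) + (k * (k * (8 * b + 3 + 2 * b)) +
        n * (k * (2 * b + 3) + 1)))
      (⋃ i, {fun w => _root_.pick (fun j i => x j i w)
        (fun j => score (SignedTest.ev fun i => z i w) ds (fun i => x j i w) + ν j w) (r w) i}) := by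
  -- The width `b` holds every key and rank, so comparisons modulo `2 ^ b` are exact.
  set u : Bits κ → Fin k → ℕ :=
    fun w j => score (SignedTest.ev fun i => z i w) ds (fun i => x j i w) + ν j w with hu
  have hub : ∀ w j, u w j < 2 ^ b := fun w j =>
    (Nat.add_le_add_right (score_le_length _ _ _) _).trans_lt (hνb w j)
  have hkeys : ∀ j, Cost Q A (ds.length * (3 + 2 * b)) (bitsOf b fun w => u w j) := by
    intro j
    have := Cost.addCount (Q := Q) (A := A) (n := 3) (b := b)
      (ds.map fun d w => d.1 fun i => Fin.append (x j) z i w) (by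
        intro f hf
        obtain ⟨d, -, rfl⟩ := List.mem_map.1 hf
        refine Cost.signedTest d fun i => ?_
        refine Fin.addCases (fun i => ?_) (fun i => ?_) i
        · rw [Fin.append_left]
          exact hx j i
        · rw [Fin.append_right]
          exact hz i) (hν j)
    rw [List.length_map] at this
    refine this.mono subset_rfl le_rfl ?_
    rintro f ⟨i, hi, rfl⟩
    refine ⟨i, hi, funext fun w => ?_⟩
    have happ : (fun i => Fin.append (x j) z i w) =
        Fin.append (fun i => x j i w) (fun i => z i w) := by
      ext i
      refine Fin.addCases (fun i => ?_) (fun i => ?_) i <;> simp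
    simp only [hu, score, List.map_map, SignedTest.ev, ← happ]
    rfl
  refine (Cost.iUnion_fin hkeys).comp (Cost.comp (Cost.iUnion_fin (n := k * (8 * b + 3 + 2 * b))
    (B := fun j => bitsOf b fun w => keyRank (u w) j) fun j => ?_) (Cost.iUnion_fin fun i => ?_))
  · have := Cost.addCount (Q := Q) (A := A ∪ ⋃ j, bitsOf b fun w => u w j) (n := 8 * b + 3)
      (b := b) ((List.finRange k).map fun i w => _root_.beats (u w) i j) (by
        intro f hf
        obtain ⟨i, -, rfl⟩ := List.mem_map.1 hf
        exact Cost.beats (fun j => (Set.subset_iUnion (fun j => bitsOf b fun w => u w j) j).trans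
          Set.subset_union_right) hub i j) (v := fun _ => 0) (by
        rintro f ⟨i, -, rfl⟩
        simpa using .inl h₀)
    rw [List.length_map, List.length_finRange] at this
    refine this.mono subset_rfl le_rfl ?_
    rintro f ⟨i, hi, rfl⟩
    refine ⟨i, hi, funext fun w => ?_⟩
    simp only [keyRank, Fin.sum_univ_def, List.map_map, add_zero]
    rfl
  · refine Cost.exists_fin (n := 2 * b + 2) fun j => ?_
    have hrank : ∀ w, keyRank (u w) j < 2 ^ b := fun w => (keyRank_lt _ _).trans_le hk
    have heq := Cost.eq (Q := Q) (b := b) (u := fun w => keyRank (u w) j) (v := r)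
      (A := (A ∪ ⋃ j, bitsOf b fun w => u w j) ∪ ⋃ j, bitsOf b fun w => keyRank (u w) j)
      ((Set.subset_iUnion (fun j => bitsOf b fun w => keyRank (u w) j) j).trans
          Set.subset_union_right)
      (hr.trans (Set.subset_union_left.trans Set.subset_union_left))
    simp only [Nat.mod_eq_of_lt (hrank _), Nat.mod_eq_of_lt (hrb _)] at heq
    have hx' : x j i ∈ (A ∪ ⋃ j, bitsOf b fun w => u w j) ∪
        ⋃ j, bitsOf b fun w => keyRank (u w) j := .inl (.inl (hx j i))
    exact (Cost.binary and heq (Cost.of_mem hx')).mono subset_rfl (by omega) subset_rfl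

lemma RandCircuit.toReal_outputLaw (S : RandCircuit Q m n) (z : Bits m) (y : Bits n) :
    (S.outputLaw z y).toReal = 𝔼 ρ, if S.run z ρ = y then (1 : ℝ) else 0 := by
  rw [RandCircuit.outputLaw, PMF.map_apply, tsum_fintype, ENNReal.toReal_sum (by
    intro ρ _
    split_ifs
    · exact PMF.apply_ne_top _ _
    · simp), Fintype.expect_eq_sum_div_card, Finset.sum_div]
  refine Finset.sum_congr rfl fun ρ _ => ?_
  by_cases h : S.run z ρ = y
  · simp [h]
  · simp [h, Ne.symm h]

theorem exists_simulator {b T L : ℕ} (ds : List (SignedTest Q)) (hT : ds.length ≤ T)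
    (hb : T + 2 ^ c ≤ 2 ^ b) (hk : k ≤ 2 ^ b) (hL : L = 2 ^ a) (hLk : L ≤ k) :
    ∃ S : RandCircuit Q m n,
      S.complexity ≤ (k * n + (k * c + a)) + (1 + (k * (T * (3 + 2 * b)) +
        (k * (k * (10 * b + 3)) + n * (k * (2 * b + 3) + 1)))) ∧
      ∀ z y, (S.outputLaw z y).toReal = leaderMean k (2 ^ c) L (score (SignedTest.ev z) ds)
        fun x => if x = y then 1 else 0 := by
  set R := k * n + (k * c + a) with hR
  set I : Set (Bits (m + R) → Bool) := Set.range (fun i w => w i) with hI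
  have hin : ∀ i, (fun w => w i) ∈ I := fun i => ⟨i, rfl⟩
  have hcost := (Cost.const (Q := Q) (A := I) false).comp
    (Cost.pick (Q := Q) (A := I ∪ {fun _ => false}) (b := b) (k := k) ds
      (z := fun i w => w (Fin.castAdd R i))
      (x := fun j i w => w (Fin.natAdd m (coinEquiv k n c a (.inl (j, i)))))
      (ν := fun j w => Nat.ofBits fun i => w (Fin.natAdd m (coinEquiv k n c a (.inr (.inl (j, i))))))
      (r := fun w => Nat.ofBits fun i => w (Fin.natAdd m (coinEquiv k n c a (.inr (.inr i)))))
      (fun i => .inl (hin _)) (fun j i => .inl (hin _))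
      (fun j => bitsOf_ofBits_subset (fun i => .inl (hin _)) (.inr rfl))
      (bitsOf_ofBits_subset (fun i => .inl (hin _)) (.inr rfl)) (.inr rfl)
      (fun w j => lt_of_lt_of_le (add_lt_add_of_le_of_lt hT (Nat.ofBits_lt_two_pow _)) hb) hk
      (fun w => (Nat.ofBits_lt_two_pow _).trans_le (hL ▸ hLk.trans hk)))
  obtain ⟨t, ht, C, -, hC⟩ := hcost 0 .inputs (by
    rintro f ⟨i, rfl⟩
    exact ⟨i, fun w => rfl⟩)
  choose o ho using fun i => hC (Set.mem_iUnion.2 ⟨i, rfl⟩)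
  refine ⟨⟨R, t, C, o⟩, ?_, fun z y => ?_⟩
  · refine Nat.add_le_add_left (ht.trans ?_) R
    rw [zero_add, (by omega : 8 * b + 3 + 2 * b = 10 * b + 3)]
    gcongr
  · rw [RandCircuit.toReal_outputLaw, ← expect_parseCoins hL hLk]
    refine Finset.expect_congr rfl fun ρ _ => ?_
    congr 2
    ext i
    refine (ho i (Fin.append z ρ)).trans ?_
    simp only [Fin.append_left, Fin.append_right]
    rfl

end Simulator

/-! ### Conditional probabilities and joint laws -/

section JointLaws

variable {n m : ℕ}

lemma toReal_sndLaw (P : PMF (Bits n × Bits m)) (z : Bits m) :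
    (sndLaw P z).toReal = ∑ x, (P (x, z)).toReal := by
  rw [sndLaw, PMF.map_apply, tsum_fintype, Fintype.sum_prod_type,
    ← ENNReal.toReal_sum fun x _ => PMF.apply_ne_top _ _]
  congr 1
  refine Finset.sum_congr rfl fun x _ => ?_
  exact (Finset.sum_eq_single z (fun z' _ h => if_neg fun h' : z = z' => h h'.symm)
    (fun h => absurd (Finset.mem_univ z) h)).trans (if_pos rfl)

lemma sum_toReal_eq_one {γ : Type*} [Fintype γ] (P : PMF γ) : ∑ x, (P x).toReal = 1 := by
  have h := P.tsum_coe
  rw [tsum_fintype] at h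
  rw [← ENNReal.toReal_sum fun x _ => PMF.apply_ne_top _ _, h, ENNReal.toReal_one]

/-- Where z has no mass the joint mass vanishes too, so the convention `0 / 0 = 0` is harmless. -/
lemma toReal_div_mul_sndLaw (P : PMF (Bits n × Bits m)) (x : Bits n) (z : Bits m) :
    (sndLaw P z).toReal * ((P (x, z)).toReal / (sndLaw P z).toReal) = (P (x, z)).toReal := by
  rcases eq_or_ne (sndLaw P z).toReal 0 with h | h
  · rw [h, zero_mul]
    rw [toReal_sndLaw, Finset.sum_eq_zero_iff_of_nonneg fun _ _ => ENNReal.toReal_nonneg] at h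
    exact (h x (Finset.mem_univ _)).symm
  · exact mul_div_cancel₀ _ h

lemma le_iSup_ratio (P : PMF (Bits n × Bits m)) (x : Bits n) (z : Bits m) :
    (P (x, z)).toReal / (sndLaw P z).toReal ≤
      ⨆ p : Bits n × Bits m, (P p).toReal / (sndLaw P p.2).toReal :=
  le_ciSup (f := fun p : Bits n × Bits m => (P p).toReal / (sndLaw P p.2).toReal)
    (Set.finite_range _).bddAbove (x, z)

lemma exists_sndLaw_ne_zero (P : PMF (Bits n × Bits m)) : ∃ z, (sndLaw P z).toReal ≠ 0 := by
  by_contra! h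
  have := sum_toReal_eq_one (sndLaw P)
  simp [h] at this

lemma sum_ratio_eq_one (P : PMF (Bits n × Bits m)) {z : Bits m} (hz : (sndLaw P z).toReal ≠ 0) :
    ∑ x, (P (x, z)).toReal / (sndLaw P z).toReal = 1 := by
  rw [← Finset.sum_div, ← toReal_sndLaw, div_self hz]

/-- A maximum is at least the average `2 ^ (-n)`; this forces Δ to be nonnegative. -/
lemma one_le_mul_iSup_ratio (P : PMF (Bits n × Bits m)) :
    1 ≤ (2 : ℝ) ^ n * ⨆ p : Bits n × Bits m, (P p).toReal / (sndLaw P p.2).toReal := by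
  obtain ⟨z, hz⟩ := exists_sndLaw_ne_zero P
  rw [← sum_ratio_eq_one P hz]
  refine (Finset.sum_le_sum fun x _ => le_iSup_ratio P x z).trans (le_of_eq ?_)
  simp

lemma iSup_ratio_pos (P : PMF (Bits n × Bits m)) :
    0 < ⨆ p : Bits n × Bits m, (P p).toReal / (sndLaw P p.2).toReal :=
  pos_of_mul_pos_right (zero_lt_one.trans_le (one_le_mul_iSup_ratio P)) (by positivity)

lemma iSup_ratio_le_one (P : PMF (Bits n × Bits m)) :
    ⨆ p : Bits n × Bits m, (P p).toReal / (sndLaw P p.2).toReal ≤ 1 := by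
  refine ciSup_le fun ⟨x, z⟩ => div_le_one_of_le₀ ?_ ENNReal.toReal_nonneg
  rw [toReal_sndLaw]
  exact Finset.single_le_sum (f := fun x => (P (x, z)).toReal)
    (fun _ _ => ENNReal.toReal_nonneg) (Finset.mem_univ x)

lemma neg_logb_le_condMinEntropy (P : PMF (Bits n × Bits m)) {B : ℝ}
    (h : ∀ x z, (P (x, z)).toReal / (sndLaw P z).toReal ≤ B) :
    -Real.logb 2 B ≤ condMinEntropy P :=
  neg_le_neg (Real.logb_le_logb_of_le one_lt_two (iSup_ratio_pos P) (ciSup_le fun p => h p.1 p.2))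

lemma iSup_ratio_eq_of_condMinEntropy {P : PMF (Bits n × Bits m)} {Δ : ℝ}
    (h : condMinEntropy P = n - Δ) :
    (2 : ℝ) ^ n * (⨆ p : Bits n × Bits m, (P p).toReal / (sndLaw P p.2).toReal) = 2 ^ Δ := by
  have hlog : Real.logb 2 (⨆ p : Bits n × Bits m, (P p).toReal / (sndLaw P p.2).toReal) =
      Δ - n := by
    rw [condMinEntropy] at h
    linarith
  rw [← Real.rpow_logb two_pos (by norm_num) (iSup_ratio_pos P), hlog, Real.rpow_sub two_pos,
    Real.rpow_natCast]
  field_simp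

lemma expect_not (P : PMF (Bits n × Bits m)) (D : Bits (n + m) → Bool) :
    expect P (fun x => !D x) = 1 - expect P D := by
  rw [← sum_toReal_eq_one P, expect, expect, ← Finset.sum_sub_distrib]
  refine Finset.sum_congr rfl fun p _ => ?_
  cases D (Fin.append p.1 p.2) <;> simp

lemma expect_eq_sum_sum (P : PMF (Bits n × Bits m)) (D : Bits (n + m) → Bool) :
    expect P D = ∑ z, (sndLaw P z).toReal * ∑ x,
      (P (x, z)).toReal / (sndLaw P z).toReal * (D (Fin.append x z)).toNat := by
  rw [expect, Fintype.sum_prod_type_right]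
  refine Finset.sum_congr rfl fun z _ => ?_
  rw [Finset.mul_sum]
  refine Finset.sum_congr rfl fun x _ => ?_
  rw [← mul_assoc, toReal_div_mul_sndLaw]
  cases D (Fin.append x z) <;> simp

variable {q : ℕ} {Q : Set (Bits q → Bool)}

namespace RandCircuit

lemma jointLaw_apply (S : RandCircuit Q m n) (μ : PMF (Bits m)) (y : Bits n) (z : Bits m) :
    S.jointLaw μ (y, z) = μ z * S.outputLaw z y := by
  rw [jointLaw, PMF.bind_apply, tsum_fintype, Finset.sum_eq_single z]
  · rw [PMF.map_apply, tsum_fintype, Finset.sum_eq_single y]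
    · simp
    · intro y' _ h
      simp [h.symm]
    · simp
  · intro z' _ h
    rw [PMF.map_apply]
    simp [h.symm]
  · simp

lemma sndLaw_jointLaw (S : RandCircuit Q m n) (μ : PMF (Bits m)) :
    sndLaw (S.jointLaw μ) = μ := by
  rw [sndLaw, jointLaw, PMF.map_bind]
  simp only [PMF.map_comp, Function.comp_def]
  have h : ∀ z, PMF.map (fun _ => z) (S.outputLaw z) = PMF.pure z := fun z => PMF.map_const _ _
  simp only [h, PMF.bind_pure]

lemma expect_jointLaw (S : RandCircuit Q m n) (μ : PMF (Bits m)) (D : Bits (n + m) → Bool) :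
    expect (S.jointLaw μ) D =
      ∑ z, (μ z).toReal * ∑ y, (S.outputLaw z y).toReal * (D (Fin.append y z)).toNat := by
  rw [expect, Fintype.sum_prod_type_right]
  refine Finset.sum_congr rfl fun z _ => ?_
  rw [Finset.mul_sum]
  refine Finset.sum_congr rfl fun x _ => ?_
  rw [jointLaw_apply, ENNReal.toReal_mul, mul_assoc]
  cases D (Fin.append x z) <;> simp

end RandCircuit

/-- `leaderMean` is linear in `φ`, so its values on indicators are the point masses of the
simulator's law. -/
lemma sum_leaderMean_indicator {α : Type*} [Fintype α] [DecidableEq α] {k N L : ℕ} (F : α → ℕ)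
    (φ : α → ℝ) :
    ∑ a, leaderMean k N L F (fun b => if b = a then 1 else 0) * φ a = leaderMean k N L F φ := by
  simp_rw [leaderMean, Finset.expect_mul, ← Finset.expect_sum_comm]
  refine Finset.expect_congr rfl fun x _ => Finset.expect_congr rfl fun ν _ => ?_
  simp_rw [div_mul_eq_mul_div, Finset.sum_mul]
  rw [← Finset.sum_div, Finset.sum_comm]
  simp

end JointLaws

/-! ### Choice of parameters -/

section Main

variable {n m : ℕ}

lemma exists_two_pow_near {x : ℝ} (hx : 1 ≤ x) : ∃ e : ℕ, x < 2 ^ e ∧ (2 : ℝ) ^ e ≤ 2 * x := by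
  obtain ⟨e, h₁, h₂⟩ := exists_nat_pow_near hx one_lt_two
  exact ⟨e + 1, h₂, by rw [pow_succ]; linarith⟩

theorem exists_simulator_indistinguishable {Q : Set (Bits (n + m) → Bool)} {ε : ℝ}
    (P : PMF (Bits n × Bits m)) {δ e k : ℕ} (he : 1 < ε * 2 ^ e)
    (hδ : ∀ x z, (P (x, z)).toReal / (sndLaw P z).toReal * 2 ^ n ≤ 2 ^ δ)
    (hk : k = 2 ^ (δ + 2 * e + 4)) :
    ∃ S : RandCircuit Q m n,
      S.complexity ≤ (k * n + (k * (δ + e + 2) + (2 * e + 4))) +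
        (1 + (k * (2 * k * (3 + 2 * (δ + 2 * e + 6))) +
        (k * (k * (10 * (δ + 2 * e + 6) + 3)) + n * (k * (2 * (δ + 2 * e + 6) + 3) + 1)))) ∧
      (∀ D ∈ Q, |expect P D - expect (S.jointLaw (sndLaw P)) D| ≤ ε) ∧
      ∀ z y, (S.outputLaw z y).toReal ≤ 2 ^ δ / 2 ^ n := by
  have hE : (0 : ℝ) < 2 ^ e := by positivity
  -- In units of `2 ^ (δ + e)` the terms `N`, `T * K / N` and `T / h` are 4, 8 and 8, while `T * ε`
  -- exceeds 32.
  have hT : (((2 ^ (δ + e + 2) : ℕ) : ℝ) + ((2 ^ (δ + 2 * e + 5) : ℕ) : ℝ) *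
      (((2 ^ δ : ℕ) : ℝ) / ((2 ^ (δ + e + 2) : ℕ) : ℝ) + 1 / ((2 ^ (e + 2) : ℕ) : ℝ))) <
      ((2 ^ (δ + 2 * e + 5) : ℕ) : ℝ) * ε := by
    have h₁ : (((2 ^ (δ + e + 2) : ℕ) : ℝ) + ((2 ^ (δ + 2 * e + 5) : ℕ) : ℝ) *
        (((2 ^ δ : ℕ) : ℝ) / ((2 ^ (δ + e + 2) : ℕ) : ℝ) + 1 / ((2 ^ (e + 2) : ℕ) : ℝ))) =
        20 * (2 ^ δ * 2 ^ e) := by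
      push_cast
      field_simp
      ring
    have h₂ : ((2 ^ (δ + 2 * e + 5) : ℕ) : ℝ) * ε = 32 * (2 ^ δ * 2 ^ e) * (ε * 2 ^ e) := by
      push_cast
      ring
    have h₃ : (0 : ℝ) < 2 ^ δ * 2 ^ e := by positivity
    rw [h₁, h₂]
    nlinarith
  obtain ⟨ds, hlen, hds⟩ := exists_list_forall_le (β := Bits m) (α := Bits n)
    (Nat.two_pow_pos δ) (Nat.two_pow_pos (e + 2)) hT
    (fun z => (sndLaw P z).toReal) (fun z => ENNReal.toReal_nonneg)
    (sum_toReal_eq_one _) (fun z x => (P (x, z)).toReal / (sndLaw P z).toReal)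
    (fun z x => div_nonneg ENNReal.toReal_nonneg ENNReal.toReal_nonneg)
    (fun z hz => sum_ratio_eq_one P hz)
    (fun z _ x => by simpa using hδ x z) (SignedTest.ev (Q := Q))
  have hk' : 2 ^ δ * (2 ^ (e + 2)) ^ 2 = k := by
    rw [hk]
    ring
  have hL : (2 ^ (e + 2)) ^ 2 = 2 ^ (2 * e + 4) := by ring
  have hLk : (2 ^ (e + 2)) ^ 2 ≤ k := hk' ▸ Nat.le_mul_of_pos_left _ (Nat.two_pow_pos δ)
  rw [hk'] at hds
  obtain ⟨S, hS, hlaw⟩ := exists_simulator (k := k) (c := δ + e + 2) (a := 2 * e + 4)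
    (b := δ + 2 * e + 6) (T := 2 * k) ds
    (hlen.le.trans (by rw [hk]; ring_nf; rfl))
    (by
      have : 2 ^ (δ + e + 2) ≤ 2 ^ (δ + 2 * e + 5) := Nat.pow_le_pow_right two_pos (by omega)
      have h : 2 ^ (δ + 2 * e + 6) = 2 * 2 ^ (δ + 2 * e + 5) := by ring
      have h' : 2 * k = 2 ^ (δ + 2 * e + 5) := by rw [hk]; ring
      omega)
    (by rw [hk]; exact Nat.pow_le_pow_right two_pos (by omega)) hL hLk
  have hadv : ∀ d : SignedTest Q, expect P d.1 - expect (S.jointLaw (sndLaw P)) d.1 ≤ ε := by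
    intro d
    rw [expect_eq_sum_sum, RandCircuit.expect_jointLaw]
    simp_rw [hlaw, sum_leaderMean_indicator _ fun y => ((d.1 (Fin.append y _)).toNat : ℝ)]
    exact hds d
  refine ⟨S, hS, fun D hD => abs_le.2 ⟨?_, hadv ⟨D, .inl hD⟩⟩, fun z y => ?_⟩
  -- Boosting bounds only the one-sided advantage; the negated test supplies the other side.
  · have := hadv ⟨fun x => !D x, .inr (by simpa using hD)⟩
    simp only [expect_not] at this
    linarith
  · rw [hlaw]
    refine (leaderMean_indicator_le (by positivity) _ y).trans (le_of_eq ?_)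
    rw [← hk']
    simp
    field_simp

lemma complexity_bound {n b c a k : ℕ} (hn : 1 ≤ n) (hk : 1 ≤ k) (hb : 1 ≤ b) (hc : c ≤ b)
    (ha : a ≤ b) :
    (k * n + (k * c + a)) + (1 + (k * (2 * k * (3 + 2 * b)) +
      (k * (k * (10 * b + 3)) + n * (k * (2 * b + 3) + 1)))) ≤ 33 * (k * k * n * b) := by
  have h₁ : k * n ≤ k * k * n * b := by
    calc k * n = k * 1 * n * 1 := by ring
      _ ≤ _ := by gcongr
  have h₂ : k * k * b ≤ k * k * n * b := by
    calc k * k * b = k * k * 1 * b := by ring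
      _ ≤ _ := by gcongr
  have h₃ : k * b ≤ k * k * b := by
    calc k * b = k * 1 * b := by ring
      _ ≤ _ := by gcongr
  have h₄ : k * c ≤ k * b := by gcongr
  have h₅ : b ≤ k * b := Nat.le_mul_of_pos_left _ hk
  have h₆ : k * k ≤ k * k * b := Nat.le_mul_of_pos_right _ hb
  have h₇ : n * (k * b) ≤ k * k * n * b := by
    calc n * (k * b) = k * 1 * n * b := by ring
      _ ≤ _ := by gcongr
  have h₈ : n ≤ k * n := Nat.le_mul_of_pos_left _ hk
  have h₉ : k * n + (k * c + a) + (1 + (k * (2 * k * (3 + 2 * b)) +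
      (k * (k * (10 * b + 3)) + n * (k * (2 * b + 3) + 1)))) =
      4 * (k * n) + k * c + a + 1 + 9 * (k * k) + 14 * (k * k * b) + 2 * (n * (k * b)) + n := by
    ring
  rw [h₉]
  omega

/-- Here `k ^ 2` contributes `K ^ 2 * ε⁻¹ ^ 4`. The word length, logarithmic in `k`, is bounded
crudely by a multiple of `n * ε⁻¹`, giving the second factor `n` and the fifth power of `ε⁻¹`. -/
lemma complexity_bound_real {n m δ e k : ℕ} {ε K : ℝ} (hn : 1 ≤ n) (hε : 0 < ε) (hε₁ : ε ≤ 1)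
    (hK : K ≤ 2 ^ n) (hδ : (2 : ℝ) ^ δ ≤ 2 * K) (he : (2 : ℝ) ^ e ≤ 2 * ε⁻¹)
    (hk : k = 2 ^ (δ + 2 * e + 4)) :
    ((33 * (k * k * n * (δ + 2 * e + 6)) : ℕ) : ℝ) ≤
      6488064 * (n * (n + m) * K ^ 2 * ε ^ (-5 : ℤ)) := by
  have hn' : (1 : ℝ) ≤ n := by exact_mod_cast hn
  have hε' : 1 ≤ ε⁻¹ := (one_le_inv₀ hε).2 hε₁
  have hK₀ : 0 ≤ K := by
    have : (0 : ℝ) < 2 ^ δ := by positivity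
    linarith
  have hδn : δ ≤ n + 1 := by
    rw [← Nat.pow_le_pow_iff_right (a := 2) one_lt_two]
    have : (2 : ℝ) ^ δ ≤ 2 ^ (n + 1) := by rw [pow_succ]; linarith
    exact_mod_cast this
  have hδn' : (δ : ℝ) ≤ n + 1 := by exact_mod_cast hδn
  have he' : (e : ℝ) ≤ 2 * ε⁻¹ := by
    refine le_trans ?_ he
    exact_mod_cast Nat.lt_two_pow_self.le
  have hb : ((δ + 2 * e + 6 : ℕ) : ℝ) ≤ 12 * (n * ε⁻¹) := by
    push_cast
    have h₁ : (n : ℝ) ≤ n * ε⁻¹ := le_mul_of_one_le_right (by positivity) hε'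
    have h₂ : ε⁻¹ ≤ n * ε⁻¹ := le_mul_of_one_le_left (by positivity) hn'
    linarith
  have hkr : (k : ℝ) ≤ 128 * (K * ε⁻¹ ^ 2) := by
    calc (k : ℝ) = 2 ^ δ * (2 ^ e) ^ 2 * 16 := by
          rw [hk]
          push_cast
          ring
      _ ≤ 2 * K * (2 * ε⁻¹) ^ 2 * 16 := by gcongr
      _ = _ := by ring
  have hz : ε ^ (-5 : ℤ) = ε⁻¹ ^ 5 := by
    rw [zpow_neg, inv_pow]
    rfl
  calc ((33 * (k * k * n * (δ + 2 * e + 6)) : ℕ) : ℝ)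
      = 33 * ((k : ℝ) * k * n * ((δ + 2 * e + 6 : ℕ) : ℝ)) := by push_cast; ring
    _ ≤ 33 * ((128 * (K * ε⁻¹ ^ 2)) * (128 * (K * ε⁻¹ ^ 2)) * n * (12 * (n * ε⁻¹))) := by
        gcongr
    _ = 6488064 * (n * (n + (0 : ℝ)) * K ^ 2 * ε⁻¹ ^ 5) := by ring
    _ ≤ 6488064 * (n * (n + m) * K ^ 2 * ε ^ (-5 : ℤ)) := by
        rw [hz]
        gcongr
        exact Nat.cast_nonneg m

lemma jointLaw_eq_of_length_zero {q : ℕ} {Q : Set (Bits q → Bool)} (S : RandCircuit Q m 0)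
    (P : PMF (Bits 0 × Bits m)) : S.jointLaw (sndLaw P) = P := by
  ext ⟨x, z⟩
  rw [RandCircuit.jointLaw_apply, ← ENNReal.toReal_eq_toReal_iff' (ENNReal.mul_ne_top
    (PMF.apply_ne_top _ _) (PMF.apply_ne_top _ _)) (PMF.apply_ne_top _ _), ENNReal.toReal_mul,
    toReal_sndLaw]
  have h := sum_toReal_eq_one (S.outputLaw z)
  rw [Fintype.sum_subsingleton _ x] at h ⊢
  rw [h, mul_one]

theorem mainTheorem4 :
    ∃ C : ℝ, 0 < C ∧ ∀ (n m s : ℕ) (Δ ε : ℝ) (P : PMF (Bits n × Bits m)),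
      0 < ε → ε ≤ 1 → condMinEntropy P = n - Δ →
      ∃ P' : PMF (Bits n × Bits m),
        sndLaw P' = sndLaw P ∧
        (∃ Sim : RandCircuit (sizeClass (n + m) s) m n,
          (Sim.complexity : ℝ) ≤ C * (n * (n + m) * (2 : ℝ) ^ (2 * Δ) * ε ^ (-5 : ℤ)) ∧
          Sim.jointLaw (sndLaw P) = P') ∧
        Indistinguishable s ε P P' ∧
        condMinEntropy P' ≥ n - Δ - 6 := by
  refine ⟨6488064, by norm_num, fun n m s Δ ε P hε hε₁ hP => ?_⟩
  rcases Nat.eq_zero_or_pos n with rfl | hn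
  -- For `n = 0` the bound is zero, so no coin or gate is allowed; the empty circuit reproduces the
  -- law exactly.
  · refine ⟨P, rfl, ⟨⟨0, 0, .inputs, Fin.elim0⟩, ?_, jointLaw_eq_of_length_zero _ P⟩, ?_, ?_⟩
    · simp [RandCircuit.complexity]
    · intro D _
      simpa using hε.le
    · rw [hP]
      linarith
  have hM := iSup_ratio_eq_of_condMinEntropy hP
  have hΔ₁ : (1 : ℝ) ≤ 2 ^ Δ := hM ▸ one_le_mul_iSup_ratio P
  have hΔn : (2 : ℝ) ^ Δ ≤ 2 ^ n := by
    rw [← hM]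
    exact mul_le_of_le_one_right (by positivity) (iSup_ratio_le_one P)
  obtain ⟨δ, hδ, hδ'⟩ := exists_two_pow_near hΔ₁
  obtain ⟨e, he, he'⟩ := exists_two_pow_near ((one_le_inv₀ hε).2 hε₁)
  obtain ⟨S, hS, hD, hlaw⟩ := exists_simulator_indistinguishable (Q := sizeClass (n + m) s)
    (ε := ε) (δ := δ) (e := e) P
    (by rwa [inv_lt_iff_one_lt_mul₀' hε] at he) (fun x z => by
      rw [mul_comm]
      exact (mul_le_mul_of_nonneg_left (le_iSup_ratio P x z) (by positivity)).trans
        (hM.le.trans hδ.le)) rfl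
  refine ⟨S.jointLaw (sndLaw P), S.sndLaw_jointLaw _, ⟨S, ?_, rfl⟩, hD, ?_⟩
  · have h₁ := hS.trans (complexity_bound hn (Nat.one_le_two_pow) (by omega) (by omega) (by omega))
    have h₂ := complexity_bound_real (m := m) hn hε hε₁ hΔn hδ' he' rfl
    rw [mul_comm (2 : ℝ) Δ, Real.rpow_mul two_pos.le, Real.rpow_two]
    exact le_trans (by exact_mod_cast h₁) h₂
  · have h := neg_logb_le_condMinEntropy (S.jointLaw (sndLaw P)) (B := 2 ^ δ / 2 ^ n) (by
      intro y z
      rw [S.sndLaw_jointLaw, RandCircuit.jointLaw_apply, ENNReal.toReal_mul]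
      rcases eq_or_ne (sndLaw P z).toReal 0 with hz | hz
      · rw [hz, div_zero]
        positivity
      · rw [mul_div_cancel_left₀ _ hz]
        exact hlaw z y)
    -- Rounding `2 ^ Δ` up to a power of two is the only loss: one bit of the six allowed.
    have hlog : Real.logb 2 (2 ^ δ / 2 ^ n) ≤ Δ + 1 - n := by
      have h₁ : (2 : ℝ) ^ δ / 2 ^ n ≤ 2 ^ (Δ + 1 - n) := by
        rw [Real.rpow_sub two_pos, Real.rpow_add two_pos, Real.rpow_one, Real.rpow_natCast,
          mul_comm ((2 : ℝ) ^ Δ)]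
        gcongr
      refine (Real.logb_le_logb_of_le one_lt_two (by positivity) h₁).trans (le_of_eq ?_)
      exact Real.logb_rpow two_pos (by norm_num)
    linarith

end Main
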